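/- Let $(M,\alpha)$ be a closed contact $3$-manifold with contact structure $\xi=\ker\alpha$, Reeb vector field $X_\alpha$ (so $\alpha(X_\alpha)=1$, $\iota_{X_\alpha}d\alpha=0$), Reeb flow $\phi^\alpha_t$, and projection $\pi_\alpha:TM\to\xi$ along $X_\alpha$. Let $J_\xi$ be a smooth complex structure on $\xi$ compatible with $d\alpha$, i.e. $d\alpha(\cdot,J_\xi\cdot)$ is a metric on $\xi$. For $\rho\in\mathbb R$ let $$J_\rho(m)=d\phi^\alpha_\rho(\phi^\alpha_{-\rho}(m))\circ J_\xi(\phi^\alpha_{-\rho}(m))\circ d\phi^\alpha_{-\rho}(m)$$ on $\xi$, extended to $T(\mathbb R\times M)$ by $(v,w)\mapsto(-\alpha(w),\,J_\rho\pi_\alpha w+vX_\alpha)$. Let $R>0$, $S^1=\mathbb R/\mathbb Z$, and let $i$ be the complex structure on $[-R,R]\times S^1$ (coordinates $(s,t)$) with $i\partial_s=\partial_t$. Let $u=(a,f):[-R,R]\times S^1\to\mathbb R\times M$ be an $\mathcal H$-holomorphic cylinder with harmonic perturbation $\gamma$: $u$ is smooth, $\gamma$ is a smooth $1$-form with $d\gamma=d(\gamma\circ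 i)=0$, and $$\pi_\alpha df\circ i=J_\xi(f)\circ\pi_\alpha df,\qquad f^*\alpha\circ i=da+\gamma .$$ Let $P=\int_{\{0\}\times S^1}\gamma$. For any map $w=(b,g):[-R,R]\times S^1\to\mathbb R\times M$ put $$E_{d\alpha}(w)=\int_{[-R,R]\times S^1} g^*d\alpha,\qquad E_\alpha(w)=\sup_{\varphi}\int_{[-R,R]\times S^1}\varphi'(b)\,db\circ i\wedge db,$$ the supremum being over all smooth $\varphi:\mathbb R\to[0,1]$ with $\varphi'\ge 0$. Then every $J_\rho$ is a smooth complex structure on $\xi$, and $\overline J_P((s,t),(r,m)):=J_{Ps}(m)$ defines, for every $(s,t)$, an $\mathbb R$-invariant almost complex structure on $\mathbb R\times M$. There is a smooth function $\Gamma$ on $[-R,R]\times S^1$ with $d\Gamma=-P\,dt+\gamma$ and vanishing mean value $\frac1{2R}\int\Gamma\,ds\,dt=0$. For every smooth $\Gamma$ with $d\Gamma=-P\,dt+\gamma$, the curve $\overline u=(\overline a,\overline f)$ with $$\overline a=a+\Gamma,\qquad \overline f(s,t)=\phi^\alpha_{Ps}(f(s,t))$$ is smooth and pseudoholomorphic for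 the domain-dependent almost complex structure $\overline J_P$, that is, $d\overline u\circ i=\overline J_P\circ d\overline u$; equivalently $$\pi_\alpha d\overline f(s,t)\circ i=J_{Ps}(\overline f(s,t))\circ\pi_\alpha d\overline f(s,t),\qquad \overline f^*\alpha\circ i=d\overline a$$ on all of $[-R,R]\times S^1$. Moreover $$E_{d\alpha}(\overline u)=E_{d\alpha}(u),\qquad E_\alpha(\overline u)\le\int_{\{R\}\times S^1}|f^*\alpha|+\int_{\{-R\}\times S^1}|f^*\alpha|+E_{d\alpha}(u).$$ -/

import Mathlib

open Set MeasureTheory Bundle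
open scoped Manifold ContDiff

namespace HCyl

/-! ### One-forms on vector spaces -/

/-- The exterior derivative `dη(v, w)` at `x` of a one-form `η` on a subset `S` of a normed
space. -/
noncomputable def dForm {E : Type*} [NormedAddCommGroup E] [NormedSpace ℝ E]
    (S : Set E) (η : E → E →L[ℝ] ℝ) (x v w : E) : ℝ :=
  fderivWithin ℝ η S x v w - fderivWithin ℝ η S x w v

/-- `dForm` is Mathlib's exterior derivative of `1`-forms. -/
theorem dForm_eq_extDerivWithin {E : Type*} [NormedAddCommGroup E] [NormedSpace ℝ E]
    {S : Set E} {η : E → E →L[ℝ] ℝ} {x : E} (hη : DifferentiableWithinAt ℝ η S x)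
    (hS : UniqueDiffWithinAt ℝ S x) (v w : E) :
    dForm S η x v w =
      extDerivWithin (fun y => ContinuousAlternatingMap.ofSubsingleton ℝ E ℝ (0 : Fin 1) (η y))
        S x ![v, w] := by
  have hd : DifferentiableWithinAt ℝ
      (fun y => ContinuousAlternatingMap.ofSubsingleton ℝ E ℝ (0 : Fin 1) (η y)) S x :=
    (ContinuousAlternatingMap.ofSubsingletonLIE (𝕜 := ℝ) (E := E) (F := ℝ)
      (0 : Fin 1)).toContinuousLinearEquiv.differentiableAt.comp_differentiableWithinAt x hη
  have h (u : E) : fderivWithin ℝ (fun y => η y u) S x = (fderivWithin ℝ η S x).flip u := by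
    have := (hη.hasFDerivWithinAt.clm_apply (hasFDerivWithinAt_const u x S)).fderivWithin hS
    simpa using this
  rw [extDerivWithin_apply hd hS]
  simp [dForm, Fin.sum_univ_two, h, Fin.removeNth, sub_eq_add_neg]

theorem dForm_add {E : Type*} [NormedAddCommGroup E] [NormedSpace ℝ E]
    (S : Set E) (η : E → E →L[ℝ] ℝ) (x v v' w : E) :
    dForm S η x (v + v') w = dForm S η x v w + dForm S η x v' w := by
  simp [dForm]; ring

theorem dForm_smul {E : Type*} [NormedAddCommGroup E] [NormedSpace ℝ E]
    (S : Set E) (η : E → E →L[ℝ] ℝ) (x : E) (c : ℝ) (v w : E) :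
    dForm S η x (c • v) w = c * dForm S η x v w := by
  simp [dForm]; ring

/-! ### Contact three-manifolds -/

section Contact

variable {M : Type*} [TopologicalSpace M] [ChartedSpace (EuclideanSpace ℝ (Fin 3)) M]

/-- The one-form `α` on `M` read in the preferred chart around `x₀`, i.e. its pullback under the
inverse of that chart. -/
noncomputable def inChart (α : (x : M) → TangentSpace (𝓡 3) x →L[ℝ] ℝ) (x₀ : M) :
    EuclideanSpace ℝ (Fin 3) → EuclideanSpace ℝ (Fin 3) →L[ℝ] ℝ :=
  fun y => (α ((extChartAt (𝓡 3) x₀).symm y)).comp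
    (mfderiv 𝓘(ℝ, EuclideanSpace ℝ (Fin 3)) (𝓡 3) (extChartAt (𝓡 3) x₀).symm y)

/-- The exterior derivative `dα(v, w)` at `x`, computed in the preferred chart around `x`, with
respect to which Mathlib identifies `T_x M` with the model space. -/
noncomputable def dAlpha (α : (x : M) → TangentSpace (𝓡 3) x →L[ℝ] ℝ) (x : M)
    (v w : TangentSpace (𝓡 3) x) : ℝ :=
  dForm (extChartAt (𝓡 3) x).target (inChart α x) (extChartAt (𝓡 3) x x) v w

/-- The value of the three-form `α ∧ dα` at `x` on three tangent vectors. -/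
noncomputable def alphaWedge (α : (x : M) → TangentSpace (𝓡 3) x →L[ℝ] ℝ) (x : M)
    (u v w : TangentSpace (𝓡 3) x) : ℝ :=
  α x u * dAlpha α x v w - α x v * dAlpha α x u w + α x w * dAlpha α x u v

/-- `α` is a (smooth) contact form: `α ∧ dα` vanishes nowhere. -/
structure IsContactForm [IsManifold (𝓡 3) ∞ M]
    (α : (x : M) → TangentSpace (𝓡 3) x →L[ℝ] ℝ) : Prop where
  smooth : ContMDiff (𝓡 3) ((𝓡 3).prod 𝓘(ℝ, EuclideanSpace ℝ (Fin 3) →L[ℝ] ℝ)) ∞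
    (fun x => TotalSpace.mk' (EuclideanSpace ℝ (Fin 3) →L[ℝ] ℝ)
      (E := fun x : M => TangentSpace (𝓡 3) x →L[ℝ] ℝ) x (α x))
  nondegenerate : ∀ x : M, ∃ u v w : TangentSpace (𝓡 3) x, alphaWedge α x u v w ≠ 0

open Classical in
/-- The Reeb vector field: the vector field `X` with `α(X) = 1` and `dα(X, ·) = 0`. -/
noncomputable def reeb (α : (x : M) → TangentSpace (𝓡 3) x →L[ℝ] ℝ) (x : M) :
    TangentSpace (𝓡 3) x :=
  if h : ∃ v : TangentSpace (𝓡 3) x, α x v = 1 ∧ ∀ w, dAlpha α x v w = 0 then h.choose else 0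

theorem exists_reeb [IsManifold (𝓡 3) ∞ M] {α : (x : M) → TangentSpace (𝓡 3) x →L[ℝ] ℝ}
    (hα : IsContactForm α) (x : M) :
    ∃! v : TangentSpace (𝓡 3) x, α x v = 1 ∧ ∀ w, dAlpha α x v w = 0 := by
  obtain ⟨e₁, e₂, e₃, he⟩ := hα.nondegenerate x
  have hadd : ∀ p q r, dAlpha α x (p + q) r = dAlpha α x p r + dAlpha α x q r :=
    dForm_add (E := EuclideanSpace ℝ (Fin 3)) _ _ _
  have hsmul : ∀ (c : ℝ) p r, dAlpha α x (c • p) r = c * dAlpha α x p r :=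
    dForm_smul (E := EuclideanSpace ℝ (Fin 3)) _ _ _
  have hanti : ∀ p q, dAlpha α x p q = -dAlpha α x q p := fun p q => by
    unfold dAlpha dForm; ring
  have hself : ∀ p, dAlpha α x p p = 0 := fun p => by have := hanti p p; linarith
  unfold alphaWedge at he
  have key : ∀ a b c : ℝ, α x (a • e₁ + b • e₂ + c • e₃) = 0 →
      (∀ w, dAlpha α x (a • e₁ + b • e₂ + c • e₃) w = 0) → a = 0 ∧ b = 0 ∧ c = 0 := by
    intro a b c h0 h1
    have h11 := h1 e₁
    have h12 := h1 e₂
    have h13 := h1 e₃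
    simp only [map_add, map_smul, smul_eq_mul, hadd, hsmul, hself] at h0 h11 h12 h13
    rw [hanti e₂ e₁, hanti e₃ e₁] at h11
    rw [hanti e₃ e₂] at h12
    refine ⟨?_, ?_, ?_⟩ <;> refine (mul_eq_zero.1 ?_).resolve_right he
    · linear_combination dAlpha α x e₂ e₃ * h0 - α x e₂ * h13 + α x e₃ * h12
    · linear_combination -dAlpha α x e₁ e₃ * h0 + α x e₁ * h13 + (-α x e₃) * h11
    · linear_combination dAlpha α x e₁ e₂ * h0 - α x e₁ * h12 + α x e₂ * h11
  have hli : LinearIndependent ℝ ![e₁, e₂, e₃] := by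
    rw [Fintype.linearIndependent_iff]
    intro g hg
    simp only [Fin.sum_univ_three, Matrix.cons_val] at hg
    obtain ⟨h0, h1, h2⟩ := key (g 0) (g 1) (g 2) (by rw [hg, map_zero]) (fun w => by
      rw [hg]; simpa using hsmul 0 0 w)
    intro i; fin_cases i <;> assumption
  have hcard : Fintype.card (Fin 3) = Module.finrank ℝ (TangentSpace (𝓡 3) x) := by
    have : Module.finrank ℝ (EuclideanSpace ℝ (Fin 3)) = 3 := by simp
    rw [Fintype.card_fin]; exact this.symm
  have hspan := hli.span_eq_top_of_card_eq_finrank hcard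
  have hdec : ∀ w : TangentSpace (𝓡 3) x, ∃ a b c : ℝ, w = a • e₁ + b • e₂ + c • e₃ := fun w => by
    have hw : w ∈ Submodule.span ℝ (Set.range ![e₁, e₂, e₃]) := hspan ▸ Submodule.mem_top
    obtain ⟨k, hk⟩ := (Submodule.mem_span_range_iff_exists_fun ℝ).1 hw
    exact ⟨k 0, k 1, k 2, by rw [← hk]; simp [Fin.sum_univ_three]⟩
  set D := α x e₁ * dAlpha α x e₂ e₃ - α x e₂ * dAlpha α x e₁ e₃ + α x e₃ * dAlpha α x e₁ e₂
    with hD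
  refine ⟨(dAlpha α x e₂ e₃ / D) • e₁ + (-dAlpha α x e₁ e₃ / D) • e₂ +
    (dAlpha α x e₁ e₂ / D) • e₃, ⟨?_, fun w => ?_⟩, fun v hv => ?_⟩
  · simp only [map_add, map_smul, smul_eq_mul]
    field_simp
    rw [hD]; ring
  · obtain ⟨a, b, c, rfl⟩ := hdec w
    rw [hanti]
    simp only [hadd, hsmul]
    rw [hanti e₁ (_ + _), hanti e₂ (_ + _), hanti e₃ (_ + _)]
    simp only [hadd, hsmul, hself]
    rw [hanti e₂ e₁, hanti e₃ e₁, hanti e₃ e₂]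
    ring
  · obtain ⟨a, b, c, rfl⟩ := hdec v
    obtain ⟨h0, h1⟩ := hv
    have h11 := h1 e₁
    have h12 := h1 e₂
    have h13 := h1 e₃
    simp only [map_add, map_smul, smul_eq_mul, hadd, hsmul, hself] at h0 h11 h12 h13
    rw [hanti e₂ e₁, hanti e₃ e₁] at h11
    rw [hanti e₃ e₂] at h12
    have ha : a = dAlpha α x e₂ e₃ / D := by
      rw [eq_div_iff he]
      linear_combination dAlpha α x e₂ e₃ * h0 - α x e₂ * h13 + α x e₃ * h12
    have hb : b = -dAlpha α x e₁ e₃ / D := by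
      rw [eq_div_iff he]
      linear_combination -dAlpha α x e₁ e₃ * h0 + α x e₁ * h13 + (-α x e₃) * h11
    have hc : c = dAlpha α x e₁ e₂ / D := by
      rw [eq_div_iff he]
      linear_combination dAlpha α x e₁ e₂ * h0 - α x e₁ * h12 + α x e₂ * h11
    rw [ha, hb, hc]

theorem reeb_spec [IsManifold (𝓡 3) ∞ M] {α : (x : M) → TangentSpace (𝓡 3) x →L[ℝ] ℝ}
    (hα : IsContactForm α) (x : M) :
    α x (reeb α x) = 1 ∧ ∀ w, dAlpha α x (reeb α x) w = 0 := by
  have h := (exists_reeb hα x).exists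
  rw [reeb, dif_pos h]
  exact h.choose_spec

open Classical in
/-- The flow `φ_t` of the Reeb vector field: `t ↦ φ_t(x)` is the integral curve through `x`. -/
noncomputable def reebFlow (α : (x : M) → TangentSpace (𝓡 3) x →L[ℝ] ℝ) (t : ℝ) (x : M) : M :=
  if h : ∃ c : ℝ → M, c 0 = x ∧ IsMIntegralCurve (I := 𝓡 3) c (reeb α) then h.choose t else x

/-- The projection `π_α : TM → ξ = ker α` along the Reeb vector field. -/
noncomputable def proj (α : (x : M) → TangentSpace (𝓡 3) x →L[ℝ] ℝ) (x : M) :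
    TangentSpace (𝓡 3) x →L[ℝ] TangentSpace (𝓡 3) x :=
  ContinuousLinearMap.id ℝ (TangentSpace (𝓡 3) x) - (α x).smulRight (reeb α x)

/-- `J` is a smooth complex structure on the plane field `ξ = ker α`. Endomorphisms of `ξ` are
represented by their extensions to `TM` that vanish on the Reeb vector field. -/
structure IsComplexStructure [IsManifold (𝓡 3) ∞ M]
    (α : (x : M) → TangentSpace (𝓡 3) x →L[ℝ] ℝ)
    (J : (x : M) → TangentSpace (𝓡 3) x →L[ℝ] TangentSpace (𝓡 3) x) : Prop where
  smooth : ContMDiff (𝓡 3)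
    ((𝓡 3).prod 𝓘(ℝ, EuclideanSpace ℝ (Fin 3) →L[ℝ] EuclideanSpace ℝ (Fin 3))) ∞
    (fun x => TotalSpace.mk' (EuclideanSpace ℝ (Fin 3) →L[ℝ] EuclideanSpace ℝ (Fin 3))
      (E := fun x : M => TangentSpace (𝓡 3) x →L[ℝ] TangentSpace (𝓡 3) x) x (J x))
  map_reeb : ∀ x : M, J x (reeb α x) = 0
  map_mem : ∀ (x : M) (v : TangentSpace (𝓡 3) x), α x v = 0 → α x (J x v) = 0
  sq : ∀ (x : M) (v : TangentSpace (𝓡 3) x), α x v = 0 → J x (J x v) = -v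

/-- `J` is compatible with `dα`: `g_J(v, w) = dα(v, J w)` is a metric on `ξ = ker α`. -/
structure IsCompatible (α : (x : M) → TangentSpace (𝓡 3) x →L[ℝ] ℝ)
    (J : (x : M) → TangentSpace (𝓡 3) x →L[ℝ] TangentSpace (𝓡 3) x) : Prop where
  symm : ∀ (x : M) (v w : TangentSpace (𝓡 3) x), α x v = 0 → α x w = 0 →
    dAlpha α x v (J x w) = dAlpha α x w (J x v)
  pos : ∀ (x : M) (v : TangentSpace (𝓡 3) x), α x v = 0 → v ≠ 0 → 0 < dAlpha α x v (J x v)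

/-- The complex structure `J_ρ(m) = dφ_ρ(φ_{-ρ}(m)) ∘ J(φ_{-ρ}(m)) ∘ dφ_{-ρ}(m)`, where `φ` is the
Reeb flow. (The outer derivative takes values in the tangent space at `φ_ρ(φ_{-ρ}(m)) = m`.) -/
noncomputable def transport (α : (x : M) → TangentSpace (𝓡 3) x →L[ℝ] ℝ)
    (J : (x : M) → TangentSpace (𝓡 3) x →L[ℝ] TangentSpace (𝓡 3) x) (ρ : ℝ) (m : M) :
    TangentSpace (𝓡 3) m →L[ℝ] TangentSpace (𝓡 3) m :=
  ((mfderiv (𝓡 3) (𝓡 3) (reebFlow α ρ) (reebFlow α (-ρ) m)).comp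
    (J (reebFlow α (-ρ) m))).comp (mfderiv (𝓡 3) (𝓡 3) (reebFlow α (-ρ)) m)

/-- The extension `(v, w) ↦ (-α(w), J(π_α w) + v X_α)` of `J` to
`T_{(r, m)}(ℝ × M) = ℝ × T_m M`. -/
noncomputable def extend (α : (x : M) → TangentSpace (𝓡 3) x →L[ℝ] ℝ)
    (J : (x : M) → TangentSpace (𝓡 3) x →L[ℝ] TangentSpace (𝓡 3) x) (q : ℝ × M) :
    (ℝ × TangentSpace (𝓡 3) q.2) →L[ℝ] (ℝ × TangentSpace (𝓡 3) q.2) :=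
  (-((α q.2).comp (ContinuousLinearMap.snd ℝ ℝ (TangentSpace (𝓡 3) q.2)))).prod
    (((J q.2).comp (proj α q.2)).comp (ContinuousLinearMap.snd ℝ ℝ (TangentSpace (𝓡 3) q.2)) +
      (ContinuousLinearMap.fst ℝ ℝ (TangentSpace (𝓡 3) q.2)).smulRight (reeb α q.2))

/-- The domain-dependent structure `J̄_P((s, t), (r, m)) = J_{Ps}(m)` on `ℝ × M`. -/
noncomputable def jBar (α : (x : M) → TangentSpace (𝓡 3) x →L[ℝ] ℝ)
    (J : (x : M) → TangentSpace (𝓡 3) x →L[ℝ] TangentSpace (𝓡 3) x) (P : ℝ) (z : ℝ × ℝ)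
    (q : ℝ × M) :
    (ℝ × TangentSpace (𝓡 3) q.2) →L[ℝ] (ℝ × TangentSpace (𝓡 3) q.2) :=
  extend α (transport α J (P * z.1)) q

end Contact

/-! ### The cylinder `[-R, R] × S¹`, `S¹ = ℝ / ℤ`

Objects on the cylinder are represented by their lifts to the strip `[-R, R] × ℝ`, with coordinates
`(s, t)`, that are `1`-periodic in `t`; values outside the strip are irrelevant. -/

/-- The strip `[-R, R] × ℝ`. -/
def strip (R : ℝ) : Set (ℝ × ℝ) := Icc (-R) R ×ˢ univ

/-- The fundamental domain `[-R, R] × [0, 1)` of the cylinder. -/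
def fund (R : ℝ) : Set (ℝ × ℝ) := Icc (-R) R ×ˢ Ico 0 1

/-- `g` is `1`-periodic in `t` on the strip. -/
def IsPeriodic {β : Type*} (R : ℝ) (g : ℝ × ℝ → β) : Prop :=
  ∀ s ∈ Icc (-R) R, ∀ t : ℝ, g (s, t + 1) = g (s, t)

/-- The standard complex structure `i`: `i ∂_s = ∂_t`, `i ∂_t = -∂_s`. -/
noncomputable def rot : (ℝ × ℝ) →L[ℝ] (ℝ × ℝ) :=
  (-(ContinuousLinearMap.snd ℝ ℝ ℝ)).prod (ContinuousLinearMap.fst ℝ ℝ ℝ)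

/-- `γ` is a smooth harmonic one-form on the cylinder: `dγ = d(γ ∘ i) = 0`. -/
structure IsHarmonicForm (R : ℝ) (γ : ℝ × ℝ → (ℝ × ℝ) →L[ℝ] ℝ) : Prop where
  smooth : ContDiffOn ℝ ∞ γ (strip R)
  periodic : IsPeriodic R γ
  closed : ∀ z ∈ strip R, ∀ v w, dForm (strip R) γ z v w = 0
  coclosed : ∀ z ∈ strip R, ∀ v w, dForm (strip R) (fun y => (γ y).comp rot) z v w = 0

/-- The period `P(γ)`, the integral of `γ` over `{0} × S¹`. -/
noncomputable def period (γ : ℝ × ℝ → (ℝ × ℝ) →L[ℝ] ℝ) : ℝ :=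
  ∫ t in (0 : ℝ)..1, γ (0, t) (0, 1)

/-- `Γ` is a smooth function on the cylinder with `dΓ = -P(γ) dt + γ`. -/
structure IsPotential (R : ℝ) (γ : ℝ × ℝ → (ℝ × ℝ) →L[ℝ] ℝ) (Γ : ℝ × ℝ → ℝ) : Prop where
  smooth : ContDiffOn ℝ ∞ Γ (strip R)
  periodic : IsPeriodic R Γ
  deriv_eq : ∀ z ∈ strip R,
    fderivWithin ℝ Γ (strip R) z = -(period γ • ContinuousLinearMap.snd ℝ ℝ ℝ) + γ z

/-! ### Curves and energies -/

section Curves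

variable {M : Type*} [TopologicalSpace M] [ChartedSpace (EuclideanSpace ℝ (Fin 3)) M]

/-- The differential of a function on the strip. -/
noncomputable def da (R : ℝ) (a : ℝ × ℝ → ℝ) (z : ℝ × ℝ) : (ℝ × ℝ) →L[ℝ] ℝ :=
  fderivWithin ℝ a (strip R) z

/-- The differential of a map from the strip to `M`. -/
noncomputable def df (R : ℝ) (f : ℝ × ℝ → M) (z : ℝ × ℝ) :
    (ℝ × ℝ) →L[ℝ] TangentSpace (𝓡 3) (f z) :=
  mfderivWithin 𝓘(ℝ, ℝ × ℝ) (𝓡 3) f (strip R) z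

/-- `u = (a, f)` is a smooth map from the cylinder `[-R, R] × S¹` to `ℝ × M`. -/
structure IsSmoothCylinder (R : ℝ) (a : ℝ × ℝ → ℝ) (f : ℝ × ℝ → M) : Prop where
  smooth_fst : ContDiffOn ℝ ∞ a (strip R)
  smooth_snd : ContMDiffOn 𝓘(ℝ, ℝ × ℝ) (𝓡 3) ∞ f (strip R)
  periodic_fst : IsPeriodic R a
  periodic_snd : IsPeriodic R f

/-- `u = (a, f)` is an `H`-holomorphic cylinder with harmonic perturbation `γ`:
`π_α df ∘ i = J(f) ∘ π_α df` and `f^*α ∘ i = da + γ`. -/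
structure IsHHolomorphic (α : (x : M) → TangentSpace (𝓡 3) x →L[ℝ] ℝ)
    (J : (x : M) → TangentSpace (𝓡 3) x →L[ℝ] TangentSpace (𝓡 3) x) (R : ℝ)
    (a : ℝ × ℝ → ℝ) (f : ℝ × ℝ → M) (γ : ℝ × ℝ → (ℝ × ℝ) →L[ℝ] ℝ) : Prop where
  smooth : IsSmoothCylinder R a f
  harmonic : IsHarmonicForm R γ
  eq_contact : ∀ z ∈ strip R, ∀ v : ℝ × ℝ,
    proj α (f z) (df R f z (rot v)) = J (f z) (proj α (f z) (df R f z v))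
  eq_reeb : ∀ z ∈ strip R, ∀ v : ℝ × ℝ,
    α (f z) (df R f z (rot v)) = da R a z v + γ z v

/-- The `dα`-energy, the integral of `f^*dα` over the cylinder. -/
noncomputable def dAlphaEnergy (α : (x : M) → TangentSpace (𝓡 3) x →L[ℝ] ℝ) (R : ℝ)
    (f : ℝ × ℝ → M) : ℝ :=
  ∫ z in fund R, dAlpha α (f z) (df R f z (1, 0)) (df R f z (0, 1))

/-- The smooth functions `φ : ℝ → [0, 1]` with `φ' ≥ 0`. -/
def admissible : Set (ℝ → ℝ) :=
  {φ | ContDiff ℝ ∞ φ ∧ (∀ r, φ r ∈ Icc (0 : ℝ) 1) ∧ ∀ r, 0 ≤ deriv φ r}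

/-- The `α`-energy, the supremum over admissible `φ` of the integral of `φ'(a) da ∘ i ∧ da` over the
cylinder, as an extended real number. -/
noncomputable def alphaEnergy (R : ℝ) (a : ℝ × ℝ → ℝ) : EReal :=
  ⨆ φ ∈ admissible, ((∫ z in fund R, deriv φ (a z) *
    (da R a z (rot (1, 0)) * da R a z (0, 1) - da R a z (rot (0, 1)) * da R a z (1, 0)) : ℝ) :
      EReal)

/-- The integral of `|f^*α|` over the circle `{s} × S¹`. -/
noncomputable def circleAlpha (α : (x : M) → TangentSpace (𝓡 3) x →L[ℝ] ℝ) (R : ℝ)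
    (f : ℝ × ℝ → M) (s : ℝ) : ℝ :=
  ∫ t in (0 : ℝ)..1, |α (f (s, t)) (df R f (s, t) (0, 1))|

/-- The map `f̄(s, t) = φ_{Ps}(f(s, t))`, with `φ` the Reeb flow. -/
noncomputable def fBar (α : (x : M) → TangentSpace (𝓡 3) x →L[ℝ] ℝ) (P : ℝ) (f : ℝ × ℝ → M) :
    ℝ × ℝ → M :=
  fun z => reebFlow α (P * z.1) (f z)

/-- `u = (a, f)` is a (smooth) pseudoholomorphic cylinder, `du ∘ i = 𝒥 ∘ du`, for the
domain-dependent endomorphism field `𝒥` of `T(ℝ × M)`. -/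
structure IsPseudoholomorphic
    (𝒥 : ℝ × ℝ → (q : ℝ × M) →
      (ℝ × TangentSpace (𝓡 3) q.2) →L[ℝ] (ℝ × TangentSpace (𝓡 3) q.2))
    (R : ℝ) (a : ℝ × ℝ → ℝ) (f : ℝ × ℝ → M) : Prop where
  smooth : IsSmoothCylinder R a f
  holo : ∀ z ∈ strip R, ∀ v : ℝ × ℝ,
    ((da R a z (rot v), df R f z (rot v)) : ℝ × TangentSpace (𝓡 3) (f z)) =
      𝒥 z (a z, f z) (da R a z v, df R f z v)

end Curves

end HCyl

/-!
The map `u ↦ ū` follows the Reeb flow `φ` for the time `P s`, and everything rests on the fact that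
`φ_t` preserves the contact form. Write `X` for the Reeb vector field. Since `φ_t^*α = α` and
`dφ_t X = X`, the differential `dφ_t` commutes with the projection `π_α`. The chain rule
`df̄ = dφ_{Ps} df + P ds ⊗ X` therefore gives two identities (`df_fBar`, `apply_df_fBar`,
`proj_df_fBar`):

* `π_α df̄ = dφ_{Ps} π_α df`, and `dφ_{Ps}` intertwines `J` with `J_{Ps}`, which gives the contact
  part of the holomorphic curve equation;
* `f̄^*α = f^*α + P ds`, hence `f̄^*α ∘ i = da + γ - P dt = d(a + Γ)`. Moreover `f̄^*dα = f^*dα`, as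
  `P ds` is closed, which is the equality of the `dα`-energies.

The potential `Γ` is a primitive of the closed form `γ - P dt` on the strip, which is convex; it
descends to the cylinder because the integral of `γ - P dt` over a circle vanishes
(`isPeriodic_of_hasFDerivWithinAt`).

For the `α`-energy put `λ = f̄^*α` and `ā = a + Γ`, and let `χ` be a test function. Then
`d(χ(ā) λ) = χ'(ā) dā ∘ i ∧ dā + χ(ā) dλ`, where `0 ≤ χ ≤ 1` and `dλ = f̄^*dα = f^*dα` is
nonnegative by compatibility of `J`. Stokes' theorem bounds the integral of the first term by
boundary integrals, in which `λ(∂_t) = α(∂_t f)` because `ds(∂_t) = 0`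
(`integral_deriv_le_of_dForm_nonneg`, `alphaEnergy_fBar_le`).

The facts about the flow are built from the following.

* Smooth dependence on initial values: the equation `b' = τ f(b)` on the fixed interval `[-1, 1]` is
  solved by the implicit function theorem in a space of continuous functions, as superposition with
  a smooth map is a smooth operator there (`ContinuousMap.contDiff_comp_left`,
  `exists_contDiffAt_integral_solution`). Compactness and the group law make the result global
  (`contMDiff_flow`).
* The Reeb vector field is smooth, being the solution of a linear system with smooth coefficients
  (`contMDiff_reeb`).
* Invariance of `α` (`apply_flowDeriv`): the exterior derivative commutes with pullback
  (`dForm_pullForm`), so the pullback `η` of `α` under `(t, y) ↦ φ_t(y)` satisfies `η(∂_t) = 1` and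
  `dη(∂_t, ·) = 0`, and its coefficients do not depend on `t`.
-/

/-! ### Smooth dependence of local flows on a vector space -/

universe u

section Superposition

variable {K : Type*} [TopologicalSpace K] [CompactSpace K]

/-- Pointwise application of a continuous bilinear map to two continuous functions. -/
noncomputable def ContinuousLinearMap.pointwise (K : Type*) [TopologicalSpace K] [CompactSpace K]
    {E F G : Type*} [NormedAddCommGroup E] [NormedSpace ℝ E] [NormedAddCommGroup F]
    [NormedSpace ℝ F] [NormedAddCommGroup G] [NormedSpace ℝ G] (B : G →L[ℝ] E →L[ℝ] F) :
    C(K, G) →L[ℝ] C(K, E) →L[ℝ] C(K, F) :=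
  LinearMap.mkContinuous₂
    (LinearMap.mk₂ ℝ
      (fun (A : C(K, G)) (h : C(K, E)) => (⟨fun k => B (A k) (h k), by fun_prop⟩ : C(K, F)))
      (fun A B h => by ext k; simp) (fun c A h => by ext k; simp)
      (fun A h g => by ext k; simp) (fun c A h => by ext k; simp)) ‖B‖
    (fun A h => by
      rw [ContinuousMap.norm_le _ (by positivity)]
      intro k
      simp only [LinearMap.mk₂_apply, ContinuousMap.coe_mk]
      exact (B.le_opNorm₂ _ _).trans
        (mul_le_mul (mul_le_mul_of_nonneg_left (A.norm_coe_le_norm k) B.opNorm_nonneg)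
          (h.norm_coe_le_norm k) (norm_nonneg _) (mul_nonneg B.opNorm_nonneg (norm_nonneg A))))

@[simp]
theorem ContinuousLinearMap.pointwise_apply {E F G : Type*} [NormedAddCommGroup E]
    [NormedSpace ℝ E] [NormedAddCommGroup F] [NormedSpace ℝ F] [NormedAddCommGroup G]
    [NormedSpace ℝ G] (B : G →L[ℝ] E →L[ℝ] F) (A : C(K, G)) (h : C(K, E)) (k : K) :
    B.pointwise K A h k = B (A k) (h k) := rfl

/-- The derivative of a superposition operator `γ ↦ f ∘ γ`. The derivative of `f` is presented as
`B ∘ f'` with values in an arbitrary normed space acting on `E`. -/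
theorem ContinuousMap.hasFDerivAt_comp_left {E F G : Type*} [NormedAddCommGroup E]
    [NormedSpace ℝ E] [NormedAddCommGroup F] [NormedSpace ℝ F] [NormedAddCommGroup G]
    [NormedSpace ℝ G] (B : G →L[ℝ] E →L[ℝ] F) (f : C(E, F)) (f' : C(E, G))
    (hf : ∀ x, HasFDerivAt f (B (f' x)) x) (γ : C(K, E)) :
    HasFDerivAt (fun γ : C(K, E) => f.comp γ) (B.pointwise K (f'.comp γ)) γ := by
  rw [hasFDerivAt_iff_isLittleO_nhds_zero, Asymptotics.isLittleO_iff]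
  intro c hc
  have hcont := (ContinuousMap.continuous_postcomp (X := K) f').continuousAt (x := γ)
  obtain ⟨δ, hδ, hball⟩ := Metric.continuousAt_iff.1 hcont (c / (‖B‖ + 1)) (by positivity)
  filter_upwards [Metric.ball_mem_nhds (0 : C(K, E)) hδ] with h hh
  rw [mem_ball_zero_iff] at hh
  rw [ContinuousMap.norm_le _ (by positivity)]
  intro k
  have hb : ∀ y ∈ Metric.closedBall (γ k) ‖h‖, ‖B (f' y) - B (f' (γ k))‖ ≤ c := by
    intro y hy
    -- a constant perturbation of `γ` turns the pointwise estimate into one in the sup norm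
    have h1 : dist (γ + ContinuousMap.const K (y - γ k)) γ < δ := by
      rw [dist_eq_norm, add_sub_cancel_left]
      refine lt_of_le_of_lt ?_ hh
      rw [ContinuousMap.norm_le _ (norm_nonneg _)]
      intro _
      simpa [dist_eq_norm] using hy
    have h2 := (ContinuousMap.dist_apply_le_dist k).trans (hball h1).le
    have h3 : ‖f' y - f' (γ k)‖ ≤ c / (‖B‖ + 1) := by simpa [dist_eq_norm] using h2
    rw [← map_sub]
    refine (B.le_opNorm _).trans ((mul_le_mul_of_nonneg_left h3 (norm_nonneg _)).trans ?_)
    rw [mul_div_assoc', div_le_iff₀ (by positivity)]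
    nlinarith [norm_nonneg B]
  have := (convex_closedBall (γ k) ‖h‖).norm_image_sub_le_of_norm_hasFDerivWithin_le'
    (f := f) (f' := fun x => B (f' x)) (φ := B (f' (γ k))) (C := c)
    (fun x _ => (hf x).hasFDerivWithinAt) hb
    (Metric.mem_closedBall_self (norm_nonneg _)) (y := γ k + h k)
    (by simpa [dist_eq_norm] using h.norm_coe_le_norm k)
  simp only [add_sub_cancel_left] at this
  simpa using this.trans (mul_le_mul_of_nonneg_left (h.norm_coe_le_norm k) hc.le)

theorem ContinuousMap.contDiff_succ_comp_left {E F G : Type*} [NormedAddCommGroup E]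
    [NormedSpace ℝ E] [NormedAddCommGroup F] [NormedSpace ℝ F] [NormedAddCommGroup G]
    [NormedSpace ℝ G] (B : G →L[ℝ] E →L[ℝ] F) (f : C(E, F)) (f' : C(E, G))
    (hf : ∀ x, HasFDerivAt f (B (f' x)) x) {n : ℕ}
    (h : ContDiff ℝ n (fun γ : C(K, E) => f'.comp γ)) :
    ContDiff ℝ (n + 1) (fun γ : C(K, E) => f.comp γ) :=
  (contDiff_succ_iff_hasFDerivAt (n := n)).2 ⟨fun γ => B.pointwise K (f'.comp γ),
    (B.pointwise K).contDiff.comp h, ContinuousMap.hasFDerivAt_comp_left B f f' hf⟩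

/-- The superposition operator `γ ↦ f ∘ γ` on continuous functions over a compact space is as
smooth as `f`. -/
theorem ContinuousMap.contDiff_comp_left {E F : Type u} [NormedAddCommGroup E] [NormedSpace ℝ E]
    (n : ℕ) [NormedAddCommGroup F] [NormedSpace ℝ F] (f : C(E, F))
    (hf : ContDiff ℝ n f) : ContDiff ℝ n (fun γ : C(K, E) => f.comp γ) := by
  induction n generalizing F with
  | zero => exact contDiff_zero.2 (ContinuousMap.continuous_postcomp f)
  | succ n ih =>
    have hf' : ContDiff ℝ n (fderiv ℝ f) := hf.fderiv_right (by norm_cast)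
    exact ContinuousMap.contDiff_succ_comp_left (G := E →L[ℝ] F) (ContinuousLinearMap.id ℝ _) f
      ⟨fderiv ℝ f, hf'.continuous⟩
      (fun x => (hf.differentiable (by norm_cast) x).hasFDerivAt) (ih _ hf')

end Superposition

section LocalFlow

/-- The operator taking a function `γ` on `[-1, 1]` to its primitive `s ↦ ∫₀ˢ γ`. -/
noncomputable def primitiveCLM (E : Type*) [NormedAddCommGroup E] [NormedSpace ℝ E] :
    C(Icc (-1 : ℝ) 1, E) →L[ℝ] C(Icc (-1 : ℝ) 1, E) :=
  LinearMap.mkContinuous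
    { toFun := fun γ => ⟨fun s => ∫ r in (0 : ℝ)..s, IccExtend (by norm_num) γ r, by
        have hc : Continuous (IccExtend (by norm_num : (-1 : ℝ) ≤ 1) γ) := γ.continuous.Icc_extend'
        exact (intervalIntegral.continuous_primitive
          (fun a b => hc.intervalIntegrable a b) 0).comp continuous_subtype_val⟩
      map_add' := fun γ η => by
        ext s
        exact intervalIntegral.integral_add
          (γ.continuous.Icc_extend'.intervalIntegrable _ _)
          (η.continuous.Icc_extend'.intervalIntegrable _ _)
      map_smul' := fun c γ => by
        ext s
        exact intervalIntegral.integral_smul c _ } 1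
    (fun γ => by
      rw [ContinuousMap.norm_le _ (by positivity)]
      intro s
      have := intervalIntegral.norm_integral_le_of_norm_le_const (a := 0) (b := (s : ℝ)) (C := ‖γ‖)
        (f := IccExtend (by norm_num : (-1 : ℝ) ≤ 1) γ) (fun x _ => γ.norm_coe_le_norm _)
      refine this.trans ?_
      have hs : |(s : ℝ) - 0| ≤ 1 := by rw [sub_zero, abs_le]; exact s.2
      nlinarith [norm_nonneg γ])

theorem primitiveCLM_apply {E : Type*} [NormedAddCommGroup E] [NormedSpace ℝ E]
    (γ : C(Icc (-1 : ℝ) 1, E)) (s : Icc (-1 : ℝ) 1) :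
    primitiveCLM E γ s = ∫ r in (0 : ℝ)..s, IccExtend (by norm_num) γ r := rfl

/-- A smooth family of solutions of `b' = τ f(b)`, `b(0) = x` on the fixed time interval `[-1, 1]`,
for `(τ, x)` near `(0, x₀)`. Putting the time into the parameter `τ` makes the linearised equation
at `τ = 0` trivial, so that the implicit function theorem applies. -/
theorem exists_contDiffAt_integral_solution {E : Type*} [NormedAddCommGroup E] [NormedSpace ℝ E]
    [CompleteSpace E] {n : ℕ} (hn : n ≠ 0) (f : C(E, E))
    (hf : ContDiff ℝ n f) (x₀ : E) :
    ∃ Γ : ℝ × E → C(Icc (-1 : ℝ) 1, E), ContDiffAt ℝ n Γ (0, x₀) ∧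
      Γ (0, x₀) = ContinuousMap.const _ x₀ ∧
      ∀ᶠ p in nhds ((0 : ℝ), x₀),
        Γ p = ContinuousMap.const _ p.2 + p.1 • primitiveCLM E (f.comp (Γ p)) := by
  set c : E →L[ℝ] C(Icc (-1 : ℝ) 1, E) := ContinuousLinearMap.const ℝ (Icc (-1 : ℝ) 1) with hc
  have hcx : ∀ x, c x = ContinuousMap.const _ x := fun x => rfl
  let G : (ℝ × E) × C(Icc (-1 : ℝ) 1, E) → C(Icc (-1 : ℝ) 1, E) :=
    fun q => q.2 - c q.1.2 - q.1.1 • primitiveCLM E (f.comp q.2)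
  have hcomp := ContinuousMap.contDiff_comp_left (K := Icc (-1 : ℝ) 1) n f hf
  have hG : ContDiff ℝ n G := by
    refine (contDiff_snd.sub (c.contDiff.comp (contDiff_snd.comp contDiff_fst))).sub
      ((contDiff_fst.comp contDiff_fst).smul
        ((primitiveCLM E).contDiff.comp (hcomp.comp contDiff_snd)))
  let u : (ℝ × E) × C(Icc (-1 : ℝ) 1, E) := ((0, x₀), c x₀)
  have hn' : (n : WithTop ℕ∞) ≠ 0 := by exact_mod_cast hn
  have hcd : ContDiffAt ℝ n G u := hG.contDiffAt
  have hinv : fderiv ℝ G u ∘L .inr ℝ (ℝ × E) C(Icc (-1 : ℝ) 1, E) =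
      ContinuousLinearMap.id ℝ _ := by
    have h1 : HasFDerivAt (fun γ : C(Icc (-1 : ℝ) 1, E) => G ((0, x₀), γ))
        (fderiv ℝ G u ∘L .inr ℝ (ℝ × E) C(Icc (-1 : ℝ) 1, E)) (c x₀) :=
      HasFDerivAt.comp (g := G) (c x₀)
        ((hG.differentiable hn' u).hasFDerivAt) (hasFDerivAt_prodMk_right _ _)
    have h2 : HasFDerivAt (fun γ : C(Icc (-1 : ℝ) 1, E) => G ((0, x₀), γ))
        (ContinuousLinearMap.id ℝ _) (c x₀) := by
      have : (fun γ : C(Icc (-1 : ℝ) 1, E) => G ((0, x₀), γ)) = fun γ => γ - c x₀ := by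
        funext γ; simp [G]
      rw [this]
      exact (hasFDerivAt_id _).sub_const _
    exact h1.unique h2
  have hi : (fderiv ℝ G u ∘L .inr ℝ (ℝ × E) C(Icc (-1 : ℝ) 1, E)).IsInvertible := by
    rw [hinv]; exact ⟨ContinuousLinearEquiv.refl ℝ _, rfl⟩
  refine ⟨hcd.implicitFunction hn' hi, hcd.contDiffAt_implicitFunction hn' hi,
    hcd.implicitFunction_apply_self hn' hi, ?_⟩
  filter_upwards [hcd.eventually_apply_implicitFunction hn' hi] with p hp
  have hu : G u = 0 := by simp [G, u]
  rw [hu] at hp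
  simp only [G] at hp
  rw [← hcx, ← sub_eq_zero, ← sub_sub]
  exact hp

/-- A solution of the integral equation `b(s) = x + τ ∫₀ˢ f(b)` solves `b' = τ f(b)`. -/
theorem hasDerivAt_of_integral_solution {E : Type*} [NormedAddCommGroup E] [NormedSpace ℝ E]
    [CompleteSpace E] (f : C(E, E)) {x : E} {τ : ℝ} {b : C(Icc (-1 : ℝ) 1, E)}
    (hb : b = ContinuousMap.const _ x + τ • primitiveCLM E (f.comp b)) {s : ℝ}
    (hs : s ∈ Ioo (-1 : ℝ) 1) :
    HasDerivAt (IccExtend (by norm_num : (-1 : ℝ) ≤ 1) b)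
      (τ • f (IccExtend (by norm_num : (-1 : ℝ) ≤ 1) b s)) s := by
  have h11 : (-1 : ℝ) ≤ 1 := by norm_num
  have hcont : Continuous (IccExtend h11 (f.comp b)) := (f.comp b).continuous.Icc_extend'
  have h1 : HasDerivAt (fun s => x + τ • ∫ r in (0 : ℝ)..s, IccExtend h11 (f.comp b) r)
      (τ • IccExtend h11 (f.comp b) s) s :=
    ((intervalIntegral.integral_hasDerivAt_right (hcont.intervalIntegrable _ _)
      (hcont.stronglyMeasurableAtFilter _ _) hcont.continuousAt).const_smul τ).const_add x
  refine h1.congr_of_eventuallyEq ?_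
  filter_upwards [Ioo_mem_nhds hs.1 hs.2] with r hr
  rw [IccExtend_of_mem h11 b ⟨hr.1.le, hr.2.le⟩]
  conv_lhs => rw [hb]
  rfl

end LocalFlow

/-! ### Smoothness of flows on compact manifolds -/

section ManifoldFlow

variable {E : Type*} [NormedAddCommGroup E] [NormedSpace ℝ E] [FiniteDimensional ℝ E]
  {M : Type*} [TopologicalSpace M] [ChartedSpace E M] [IsManifold 𝓘(ℝ, E) ∞ M]

omit [FiniteDimensional ℝ E] in
/-- The derivative of the inverse chart recovers a tangent vector from its coordinates. -/
theorem mfderiv_extChartAt_symm_trivializationAt {x₀ x : M} (hx : x ∈ (chartAt E x₀).source)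
    (w : TangentSpace 𝓘(ℝ, E) x) :
    mfderiv 𝓘(ℝ, E) 𝓘(ℝ, E) (extChartAt 𝓘(ℝ, E) x₀).symm (extChartAt 𝓘(ℝ, E) x₀ x)
      (trivializationAt E (TangentSpace 𝓘(ℝ, E)) x₀ ⟨x, w⟩).2 = w := by
  have h2 := TangentBundle.symmL_trivializationAt (I := 𝓘(ℝ, E)) hx
  rw [modelWithCornersSelf_coe, range_id, mfderivWithin_univ] at h2
  have h3 := (trivializationAt E (TangentSpace 𝓘(ℝ, E)) x₀).symmL_continuousLinearMapAt
    (R := ℝ) (b := x) (by simpa using hx) w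
  rw [h2, Trivialization.continuousLinearMapAt_apply, Trivialization.linearMapAt_apply,
    if_pos (by simpa using hx)] at h3
  exact h3

/-- A smooth vector field agrees near a point with one that, read in the chart, extends smoothly to
the whole model space. -/
theorem exists_contDiff_chart_vectorField {v : (x : M) → TangentSpace 𝓘(ℝ, E) x}
    (hv : ContMDiff 𝓘(ℝ, E) 𝓘(ℝ, E).tangent ∞ (fun x => (⟨x, v x⟩ : TangentBundle 𝓘(ℝ, E) M)))
    (x₀ : M) :
    ∃ f : E → E, ContDiff ℝ ∞ f ∧ ∀ᶠ y in nhds (extChartAt 𝓘(ℝ, E) x₀ x₀),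
      mfderiv 𝓘(ℝ, E) 𝓘(ℝ, E) (extChartAt 𝓘(ℝ, E) x₀).symm y (f y) =
        v ((extChartAt 𝓘(ℝ, E) x₀).symm y) := by
  set ψ := extChartAt 𝓘(ℝ, E) x₀ with hψ
  let e := trivializationAt E (TangentSpace 𝓘(ℝ, E)) x₀
  let X : E → E := fun y => (e ⟨ψ.symm y, v (ψ.symm y)⟩).2
  have ht : ψ.target ∈ nhds (ψ x₀) :=
    (isOpen_extChartAt_target x₀).mem_nhds (mem_extChartAt_target x₀)
  have hX : ContDiffOn ℝ ∞ X ψ.target := by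
    rw [← contMDiffOn_iff_contDiffOn]
    have h1 : ContMDiffOn 𝓘(ℝ, E) 𝓘(ℝ, E) ∞ (fun x => (e ⟨x, v x⟩).2) (chartAt E x₀).source := by
      have := (e.contMDiffOn_iff (IB := 𝓘(ℝ, E)) (n := ∞) (IM := 𝓘(ℝ, E)) (M := M)
        (f := fun x => (⟨x, v x⟩ : TangentBundle 𝓘(ℝ, E) M)) (s := (chartAt E x₀).source)
        (fun x hx => by simpa [e] using hx)).1 hv.contMDiffOn
      exact this.2
    refine h1.comp (contMDiffOn_extChartAt_symm x₀) ?_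
    intro y hy
    simpa [hψ] using (extChartAt 𝓘(ℝ, E) x₀).map_target hy
  obtain ⟨r, hr, hball⟩ := Metric.mem_nhds_iff.1 ht
  let χ : ContDiffBump (ψ x₀) := ⟨r / 4, r / 2, by positivity, by linarith⟩
  refine ⟨fun y => χ y • X y, ?_, ?_⟩
  · refine contDiff_iff_contDiffAt.2 fun y => ?_
    by_cases hy : y ∈ tsupport (fun y => χ y • X y)
    swap
    · exact contDiffAt_const.congr_of_eventuallyEq (notMem_tsupport_iff_eventuallyEq.1 hy)
    have hy' : y ∈ ψ.target := by
      have := tsupport_smul_subset_left _ _ hy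
      rw [χ.tsupport_eq] at this
      refine hball (Metric.closedBall_subset_ball ?_ this)
      change r / 2 < r
      linarith
    exact χ.contDiff.contDiffAt.smul
      (hX.contDiffAt ((isOpen_extChartAt_target x₀).mem_nhds hy'))
  · filter_upwards [χ.eventuallyEq_one, ht] with y h1 hy
    have hs : ψ.symm y ∈ (chartAt E x₀).source := by
      simpa [hψ] using (extChartAt 𝓘(ℝ, E) x₀).map_target hy
    have h2 := mfderiv_extChartAt_symm_trivializationAt hs (v (ψ.symm y))
    rw [← hψ, ψ.right_inv hy] at h2
    simp only [h1, Pi.one_apply, one_smul]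
    exact h2

/-- Integral curves of `τ • v` on `(-1, 1)` starting at `x` can be chosen to depend smoothly on
`(τ, x)` near `(0, x₀)`. -/
theorem exists_contMDiffAt_isMIntegralCurveOn {v : (x : M) → TangentSpace 𝓘(ℝ, E) x}
    (hv : ContMDiff 𝓘(ℝ, E) 𝓘(ℝ, E).tangent ∞ (fun x => (⟨x, v x⟩ : TangentBundle 𝓘(ℝ, E) M)))
    (x₀ : M) {n : ℕ} (hn : n ≠ 0) :
    ∃ B : ℝ × M → ℝ → M,
      (∀ᶠ p in nhds ((0 : ℝ), x₀), B p 0 = p.2 ∧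
        IsMIntegralCurveOn (I := 𝓘(ℝ, E)) (B p) (p.1 • v) (Ioo (-1) 1)) ∧
      ContMDiffAt (𝓘(ℝ, ℝ).prod 𝓘(ℝ, E)) 𝓘(ℝ, E) n (fun p => B p (1 / 2)) (0, x₀) := by
  have : CompleteSpace E := FiniteDimensional.complete ℝ E
  obtain ⟨f, hf, hfv⟩ := exists_contDiff_chart_vectorField hv x₀
  set ψ := extChartAt 𝓘(ℝ, E) x₀ with hψ
  have ht : ψ.target ∈ nhds (ψ x₀) :=
    (isOpen_extChartAt_target x₀).mem_nhds (mem_extChartAt_target x₀)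
  obtain ⟨Γ, hΓ, hΓ0, hΓe⟩ := exists_contDiffAt_integral_solution hn ⟨f, hf.continuous⟩
    (hf.of_le (mod_cast le_top)) (ψ x₀)
  have h11 : (-1 : ℝ) ≤ 1 := by norm_num
  let Q : ℝ × M → ℝ × E := fun p => (p.1, ψ p.2)
  have hQ : ContMDiffAt (𝓘(ℝ, ℝ).prod 𝓘(ℝ, E)) 𝓘(ℝ, ℝ × E) n Q (0, x₀) := by
    refine contMDiffAt_fst.prodMk_space ?_
    exact (contMDiffAt_extChartAt (I := 𝓘(ℝ, E)) (x := x₀)).comp (0, x₀) contMDiffAt_snd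
  have hQc : Filter.Tendsto Q (nhds (0, x₀)) (nhds (0, ψ x₀)) := hQ.continuousAt
  refine ⟨fun p s => ψ.symm (IccExtend h11 (Γ (Q p)) s), ?_, ?_⟩
  · obtain ⟨δ, hδ, hball⟩ := Metric.mem_nhds_iff.1 (Filter.inter_mem hfv ht)
    have hclose : ∀ᶠ q in nhds ((0 : ℝ), ψ x₀),
        dist (Γ q) (ContinuousMap.const _ (ψ x₀)) < δ := by
      have := hΓ.continuousAt
      rw [ContinuousAt, hΓ0] at this
      exact this (Metric.ball_mem_nhds _ hδ)
    have hsrc : ∀ᶠ p in nhds ((0 : ℝ), x₀), p.2 ∈ ψ.source :=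
      continuousAt_snd.eventually (extChartAt_source_mem_nhds (I := 𝓘(ℝ, E)) x₀)
    filter_upwards [hQc.eventually hclose, hQc.eventually hΓe, hsrc] with p h1 h2 h3
    have hmem : ∀ s, IccExtend h11 (Γ (Q p)) s ∈ Metric.ball (ψ x₀) δ := fun s =>
      lt_of_le_of_lt (ContinuousMap.dist_apply_le_dist (f := Γ (Q p))
        (g := ContinuousMap.const _ (ψ x₀)) _) h1
    constructor
    · have h0 : (0 : ℝ) ∈ Icc (-1 : ℝ) 1 := by norm_num
      have : IccExtend h11 (Γ (Q p)) 0 = ψ p.2 := by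
        rw [IccExtend_of_mem h11 _ h0, h2]
        simp [primitiveCLM_apply, Q]
      change ψ.symm _ = _
      rw [this, ψ.left_inv h3]
    · intro s hs
      have hd := (hasDerivAt_of_integral_solution _ h2 hs).hasFDerivAt.hasMFDerivAt
      set y := IccExtend h11 (Γ (Q p)) s with hy
      have hy' := hball (hmem s)
      have hsymm : HasMFDerivAt 𝓘(ℝ, E) 𝓘(ℝ, E) ψ.symm y (mfderiv 𝓘(ℝ, E) 𝓘(ℝ, E) ψ.symm y) := by
        refine MDifferentiableAt.hasMFDerivAt ?_
        exact ((contMDiffOn_extChartAt_symm (n := ∞) x₀).contMDiffAt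
          ((isOpen_extChartAt_target x₀).mem_nhds hy'.2)).mdifferentiableAt (by simp)
      have hcomp := (HasMFDerivAt.comp s hsymm hd).hasMFDerivWithinAt (s := Ioo (-1 : ℝ) 1)
      refine hcomp.congr_mfderiv ?_
      ext
      let L : E →L[ℝ] E := mfderiv 𝓘(ℝ, E) 𝓘(ℝ, E) ψ.symm y
      have hL : L (f y) = v (ψ.symm y) := hy'.1
      change L ((1 : ℝ) • (p.1 • f y)) = (1 : ℝ) • (p.1 • (v (ψ.symm y) : E))
      rw [map_smul, map_smul, hL]
      rfl
  · have h1 : (1 / 2 : ℝ) ∈ Icc (-1 : ℝ) 1 := by norm_num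
    have hev : ContDiffAt ℝ n (fun q => Γ q ⟨1 / 2, h1⟩) (0, ψ x₀) := by
      have hcd := (ContinuousMap.evalCLM ℝ (⟨1 / 2, h1⟩ : Icc (-1 : ℝ) 1) :
        C(Icc (-1 : ℝ) 1, E) →L[ℝ] E).contDiff (n := n)
      exact hcd.contDiffAt.comp (0, ψ x₀) hΓ
    have hev' : ContMDiffAt (𝓘(ℝ, ℝ).prod 𝓘(ℝ, E)) 𝓘(ℝ, E) n
        (fun p => Γ (Q p) ⟨1 / 2, h1⟩) (0, x₀) :=
      ContMDiffAt.comp (I' := 𝓘(ℝ, ℝ × E)) (0, x₀) (g := fun q => Γ q ⟨1 / 2, h1⟩)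
        hev.contMDiffAt hQ
    have hsymm : ContMDiffAt 𝓘(ℝ, E) 𝓘(ℝ, E) n ψ.symm (Γ (Q (0, x₀)) ⟨1 / 2, h1⟩) := by
      refine (contMDiffOn_extChartAt_symm (n := n) x₀).contMDiffAt ?_
      change ψ.target ∈ nhds (Γ (0, ψ x₀) ⟨1 / 2, h1⟩)
      rw [hΓ0]
      exact ht
    refine (ContMDiffAt.comp (0, x₀) hsymm hev').congr_of_eventuallyEq ?_
    filter_upwards with p
    simp only [Function.comp_apply]
    rw [IccExtend_of_mem h11 _ h1]

variable [T2Space M]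

section GlobalFlow

variable {v : (x : M) → TangentSpace 𝓘(ℝ, E) x} {φ : ℝ → M → M}

theorem flow_add_of_isMIntegralCurve
    (hv : ContMDiff 𝓘(ℝ, E) 𝓘(ℝ, E).tangent ∞ (fun x => (⟨x, v x⟩ : TangentBundle 𝓘(ℝ, E) M)))
    (h0 : ∀ x, φ 0 x = x) (hφ : ∀ x, IsMIntegralCurve (I := 𝓘(ℝ, E)) (fun t => φ t x) v)
    (s t : ℝ) (x : M) : φ (s + t) x = φ s (φ t x) := by
  have : CompleteSpace E := FiniteDimensional.complete ℝ E
  have := isMIntegralCurve_Ioo_eq_of_contMDiff_boundaryless (t₀ := 0)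
    (hv.of_le (mod_cast le_top)) ((hφ x).comp_add t) (hφ (φ t x)) (by simp [h0])
  exact congrFun this s

theorem contMDiffAt_flow_zero
    (hv : ContMDiff 𝓘(ℝ, E) 𝓘(ℝ, E).tangent ∞ (fun x => (⟨x, v x⟩ : TangentBundle 𝓘(ℝ, E) M)))
    (h0 : ∀ x, φ 0 x = x) (hφ : ∀ x, IsMIntegralCurve (I := 𝓘(ℝ, E)) (fun t => φ t x) v)
    {n : ℕ} (hn : n ≠ 0) (x₀ : M) :
    ContMDiffAt (𝓘(ℝ, ℝ).prod 𝓘(ℝ, E)) 𝓘(ℝ, E) n (fun p : ℝ × M => φ p.1 p.2) (0, x₀) := by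
  have : CompleteSpace E := FiniteDimensional.complete ℝ E
  obtain ⟨B, hB, hBs⟩ := exists_contMDiffAt_isMIntegralCurveOn hv x₀ hn
  let D : ℝ × M → ℝ × M := fun p => (p.1 * 2, p.2)
  have hD : ContMDiff (𝓘(ℝ, ℝ).prod 𝓘(ℝ, E)) (𝓘(ℝ, ℝ).prod 𝓘(ℝ, E)) n D :=
    (((contDiff_id.mul contDiff_const).contMDiff (f := fun t : ℝ => t * 2)).comp
      contMDiff_fst).prodMk contMDiff_snd
  have hD0 : D (0, x₀) = (0, x₀) := by simp [D]
  have hDt : Filter.Tendsto D (nhds (0, x₀)) (nhds (0, x₀)) := by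
    conv_rhs => rw [← hD0]
    exact hD.continuous.continuousAt
  have hc : ContMDiffAt (𝓘(ℝ, ℝ).prod 𝓘(ℝ, E)) 𝓘(ℝ, E) n (fun p => B (D p) (1 / 2)) (0, x₀) :=
    ContMDiffAt.comp (0, x₀) (g := fun p => B p (1 / 2)) (by rw [hD0]; exact hBs) hD.contMDiffAt
  refine hc.congr_of_eventuallyEq ?_
  filter_upwards [hDt.eventually hB] with p ⟨hp0, hp⟩
  have hτv : ContMDiff 𝓘(ℝ, E) 𝓘(ℝ, E).tangent 1
      (fun x => (⟨x, (p.1 * 2) • v x⟩ : TangentBundle 𝓘(ℝ, E) M)) :=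
    (hv.of_le (mod_cast le_top)).const_smul_section
  -- rescaling time turns the flow line into an integral curve of `(2t) • v`, seen at time `1 / 2`
  have h2 := ((hφ p.2).comp_mul (p.1 * 2)).isMIntegralCurveOn (Ioo (-1 : ℝ) 1)
  have h3 := isMIntegralCurveOn_Ioo_eqOn_of_contMDiff_boundaryless (t₀ := 0) (by norm_num) hτv h2
    hp (by simp [h0, hp0, D])
  have h4 := h3 (show (1 / 2 : ℝ) ∈ Ioo (-1 : ℝ) 1 by norm_num)
  rw [← h4]
  simp only [Function.comp_apply]
  congr 1
  ring

variable [CompactSpace M]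

theorem exists_isMIntegralCurve_of_compactSpace {v : (x : M) → TangentSpace 𝓘(ℝ, E) x}
    (hv : ContMDiff 𝓘(ℝ, E) 𝓘(ℝ, E).tangent ∞ (fun x => (⟨x, v x⟩ : TangentBundle 𝓘(ℝ, E) M)))
    (x : M) : ∃ c : ℝ → M, c 0 = x ∧ IsMIntegralCurve (I := 𝓘(ℝ, E)) c v := by
  have : CompleteSpace E := FiniteDimensional.complete ℝ E
  have hloc : ∀ x₀ ∈ (univ : Set M), ∀ᶠ p in nhds x₀ ×ˢ nhds (0 : ℝ),
      ∃ b : ℝ → M, b 0 = p.1 ∧ IsMIntegralCurveOn (I := 𝓘(ℝ, E)) b (p.2 • v) (Ioo (-1) 1) := by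
    intro x₀ _
    obtain ⟨B, hB, -⟩ := exists_contMDiffAt_isMIntegralCurveOn hv x₀ one_ne_zero
    rw [nhds_prod_eq] at hB
    filter_upwards [Filter.eventually_swap_iff.1 hB] with p hp
    exact ⟨_, hp⟩
  have hunif : ∀ᶠ τ in nhds (0 : ℝ), ∀ x ∈ (univ : Set M),
      ∃ b : ℝ → M, b 0 = x ∧ IsMIntegralCurveOn (I := 𝓘(ℝ, E)) b (τ • v) (Ioo (-1) 1) := by
    have := isCompact_univ.eventually_forall_of_forall_eventually (x₀ := (0 : ℝ))
      (K := (univ : Set M)) (P := fun τ x => ∃ b : ℝ → M, b 0 = x ∧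
        IsMIntegralCurveOn (I := 𝓘(ℝ, E)) b (τ • v) (Ioo (-1) 1)) ?_
    · exact this
    · intro y hy
      rw [nhds_prod_eq]
      exact Filter.eventually_swap_iff.1 (hloc y hy)
  obtain ⟨τ, hτ, hτpos⟩ : ∃ τ : ℝ, (∀ x ∈ (univ : Set M), ∃ b : ℝ → M, b 0 = x ∧
      IsMIntegralCurveOn (I := 𝓘(ℝ, E)) b (τ • v) (Ioo (-1) 1)) ∧ 0 < τ :=
    ((hunif.filter_mono nhdsWithin_le_nhds).and
      (self_mem_nhdsWithin : Ioi (0 : ℝ) ∈ nhdsWithin 0 (Ioi 0))).exists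
  refine exists_isMIntegralCurve_of_isMIntegralCurveOn (hv.of_le (mod_cast le_top)) hτpos
    (fun y => ?_) x
  obtain ⟨b, hb0, hb⟩ := hτ y (mem_univ y)
  refine ⟨b ∘ (· * τ⁻¹), by simp [hb0], ?_⟩
  have := hb.comp_mul τ⁻¹
  rw [smul_smul, inv_mul_cancel₀ hτpos.ne', one_smul] at this
  refine this.mono fun t ht => ?_
  rw [mem_Ioo] at ht
  rw [mem_ofPred_eq, mem_Ioo, ← div_eq_mul_inv, lt_div_iff₀ hτpos, div_lt_iff₀ hτpos]
  constructor <;> linarith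

/-- The flow of a smooth vector field on a compact manifold is smooth in time and space. -/
theorem contMDiff_flow
    (hv : ContMDiff 𝓘(ℝ, E) 𝓘(ℝ, E).tangent ∞ (fun x => (⟨x, v x⟩ : TangentBundle 𝓘(ℝ, E) M)))
    (h0 : ∀ x, φ 0 x = x) (hφ : ∀ x, IsMIntegralCurve (I := 𝓘(ℝ, E)) (fun t => φ t x) v) :
    ContMDiff (𝓘(ℝ, ℝ).prod 𝓘(ℝ, E)) 𝓘(ℝ, E) ∞ (fun p : ℝ × M => φ p.1 p.2) := by
  suffices h : ∀ n : ℕ, n ≠ 0 →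
      ContMDiff (𝓘(ℝ, ℝ).prod 𝓘(ℝ, E)) 𝓘(ℝ, E) n (fun p : ℝ × M => φ p.1 p.2) by
    rw [contMDiff_infty]
    intro n
    exact (h (n + 1) n.succ_ne_zero).of_le (mod_cast n.le_succ)
  intro n hn
  let A : ℝ → Prop := fun t => ∀ x : M,
    ContMDiffAt (𝓘(ℝ, ℝ).prod 𝓘(ℝ, E)) 𝓘(ℝ, E) n (fun p : ℝ × M => φ p.1 p.2) (t, x)
  have hA0 : ∀ᶠ t in nhds (0 : ℝ), A t := by
    have := isCompact_univ.eventually_forall_of_forall_eventually (x₀ := (0 : ℝ))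
      (K := (univ : Set M)) (P := fun t x => ContMDiffAt (𝓘(ℝ, ℝ).prod 𝓘(ℝ, E)) 𝓘(ℝ, E) n
        (fun p : ℝ × M => φ p.1 p.2) (t, x)) ?_
    · filter_upwards [this] with t ht x using ht x (mem_univ x)
    · intro y _
      exact (contMDiffAt_iff_contMDiffAt_nhds (by simp)).1 (contMDiffAt_flow_zero hv h0 hφ hn y)
  obtain ⟨ε, hε, hAε⟩ := Metric.eventually_nhds_iff.1 hA0
  have hadd : ∀ s r : ℝ, A s → A r → A (s + r) := by
    intro s r hs hr x
    have h1 : ContMDiffAt (𝓘(ℝ, ℝ).prod 𝓘(ℝ, E)) 𝓘(ℝ, E) n (fun p : ℝ × M => φ r p.2)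
        (s + r, x) :=
      ContMDiffAt.comp (s + r, x) (g := fun p : ℝ × M => φ p.1 p.2)
        (f := fun p : ℝ × M => (r, p.2)) (hr x) (contMDiffAt_const.prodMk contMDiffAt_snd)
    have h2 : ContMDiffAt (𝓘(ℝ, ℝ).prod 𝓘(ℝ, E)) 𝓘(ℝ, ℝ) n (fun p : ℝ × M => p.1 - r)
        (s + r, x) :=
      ((contDiff_id.sub contDiff_const).contMDiff (f := fun t : ℝ => t - r)).contMDiffAt.comp
        (s + r, x) contMDiffAt_fst
    have h3 := ContMDiffAt.comp (s + r, x) (g := fun p : ℝ × M => φ p.1 p.2)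
      (f := fun p : ℝ × M => (p.1 - r, φ r p.2)) (by simpa using hs (φ r x)) (h2.prodMk h1)
    refine h3.congr_of_eventuallyEq ?_
    filter_upwards with p
    simp only [Function.comp_apply]
    rw [← flow_add_of_isMIntegralCurve hv h0 hφ, sub_add_cancel]
  rintro ⟨t, x⟩
  obtain ⟨N, hN⟩ := exists_nat_gt (|t| / ε)
  have hNpos : (0 : ℝ) < N := lt_of_le_of_lt (by positivity) hN
  have hstep : A (t / N) := hAε (by
    rw [dist_zero_right, Real.norm_eq_abs, abs_div, abs_of_pos hNpos, div_lt_iff₀ hNpos]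
    rw [div_lt_iff₀ hε] at hN
    linarith)
  have hall : ∀ k : ℕ, A (k * (t / N)) := by
    intro k
    induction k with
    | zero => simpa using hAε (by simpa using hε)
    | succ k ih =>
      have := hadd _ _ ih hstep
      rwa [show (k : ℝ) * (t / N) + t / N = ((k + 1 : ℕ) : ℝ) * (t / N) by push_cast; ring] at this
  have := hall N x
  rwa [mul_div_cancel₀ t hNpos.ne'] at this

end GlobalFlow

end ManifoldFlow

namespace HCyl

/-! ### Pullbacks of one-forms -/

section Pullback

variable {M : Type*} [TopologicalSpace M] [ChartedSpace (EuclideanSpace ℝ (Fin 3)) M]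
  {F : Type*} [NormedAddCommGroup F] [NormedSpace ℝ F]

/-- The pullback `g^*α` to a subset `S` of a normed space. -/
noncomputable def pullForm (α : (x : M) → TangentSpace (𝓡 3) x →L[ℝ] ℝ) (S : Set F) (g : F → M)
    (z : F) : F →L[ℝ] ℝ :=
  (α (g z)).comp (mfderivWithin 𝓘(ℝ, F) (𝓡 3) g S z)

variable [IsManifold (𝓡 3) ∞ M] {α : (x : M) → TangentSpace (𝓡 3) x →L[ℝ] ℝ}

theorem contDiffAt_inChart
    (hα : ContMDiff (𝓡 3) ((𝓡 3).prod 𝓘(ℝ, EuclideanSpace ℝ (Fin 3) →L[ℝ] ℝ)) ∞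
      (fun x => TotalSpace.mk' (EuclideanSpace ℝ (Fin 3) →L[ℝ] ℝ)
        (E := fun x : M => TangentSpace (𝓡 3) x →L[ℝ] ℝ) x (α x))) (x₀ : M) :
    ContDiffAt ℝ ∞ (inChart α x₀) (extChartAt (𝓡 3) x₀ x₀) := by
  set ψ := extChartAt (𝓡 3) x₀ with hψ
  have h1 := ((contMDiffAt_hom_bundle (E₂ := Bundle.Trivial M ℝ) _).1 (hα x₀)).2
  have hx₀ : ψ.symm (ψ x₀) = x₀ := ψ.left_inv (mem_extChartAt_source x₀)
  have ht : ψ.target ∈ nhds (ψ x₀) :=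
    (isOpen_extChartAt_target x₀).mem_nhds (mem_extChartAt_target x₀)
  have h2 : ContMDiffAt 𝓘(ℝ, EuclideanSpace ℝ (Fin 3)) (𝓡 3) ∞ ψ.symm (ψ x₀) :=
    (contMDiffOn_extChartAt_symm x₀).contMDiffAt ht
  have h3 := ContMDiffAt.comp_of_eq (x := ψ x₀) h1 h2 hx₀
  refine h3.contDiffAt.congr_of_eventuallyEq ?_
  filter_upwards [ht] with y hy
  have hs : ψ.symm y ∈ (chartAt (EuclideanSpace ℝ (Fin 3)) x₀).source := by
    simpa [hψ] using ψ.map_target hy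
  have h4 := TangentBundle.symmL_trivializationAt (I := 𝓡 3) hs
  rw [← hψ, ψ.right_inv hy, modelWithCornersSelf_coe, range_id, mfderivWithin_univ] at h4
  simp only [Function.comp_apply, ContinuousLinearMap.inCoordinates, inChart]
  rw [h4]
  ext w
  simp
  rfl

theorem inChart_comp_fderivWithin_eventuallyEq_pullForm {S : Set F} (hS : UniqueDiffOn ℝ S)
    {g : F → M} (hg : ContMDiffOn 𝓘(ℝ, F) (𝓡 3) ∞ g S) {z : F} (hz : z ∈ S) :
    ∀ᶠ z' in nhdsWithin z S, pullForm α S g z' =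
      (inChart α (g z) (extChartAt (𝓡 3) (g z) (g z'))).comp
        (fderivWithin ℝ (extChartAt (𝓡 3) (g z) ∘ g) S z') := by
  set ψ := extChartAt (𝓡 3) (g z) with hψ
  have hsrc : ∀ᶠ z' in nhdsWithin z S, g z' ∈ ψ.source :=
    (hg z hz).continuousWithinAt (extChartAt_source_mem_nhds (I := 𝓡 3) (g z))
  filter_upwards [eventually_eventually_nhdsWithin.2 hsrc, hsrc, self_mem_nhdsWithin]
    with z' hev h1 hz'
  have hmem : ψ (g z') ∈ ψ.target := ψ.map_source h1
  have hsymm : MDifferentiableAt 𝓘(ℝ, EuclideanSpace ℝ (Fin 3)) (𝓡 3) ψ.symm (ψ (g z')) :=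
    ((contMDiffOn_extChartAt_symm (n := ∞) (g z)).contMDiffAt
      ((isOpen_extChartAt_target (g z)).mem_nhds hmem)).mdifferentiableAt (by simp)
  have hchart : MDifferentiableAt (𝓡 3) 𝓘(ℝ, EuclideanSpace ℝ (Fin 3)) ψ (g z') :=
    mdifferentiableAt_extChartAt (by simpa [hψ] using h1)
  have hgz : MDifferentiableWithinAt 𝓘(ℝ, F) (𝓡 3) g S z' :=
    (hg z' hz').mdifferentiableWithinAt (by simp)
  have hu : UniqueMDiffWithinAt 𝓘(ℝ, F) S z' := (hS z' hz').uniqueMDiffWithinAt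
  have hcongr : mfderivWithin 𝓘(ℝ, F) (𝓡 3) (ψ.symm ∘ (ψ ∘ g)) S z' =
      mfderivWithin 𝓘(ℝ, F) (𝓡 3) g S z' := by
    refine Filter.EventuallyEq.mfderivWithin_eq ?_ ?_
    · filter_upwards [hev] with y hy using ψ.left_inv hy
    · exact ψ.left_inv h1
  have hchain : mfderivWithin 𝓘(ℝ, F) (𝓡 3) (ψ.symm ∘ (ψ ∘ g)) S z' =
      (mfderiv 𝓘(ℝ, EuclideanSpace ℝ (Fin 3)) (𝓡 3) ψ.symm (ψ (g z'))).comp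
        (mfderivWithin 𝓘(ℝ, F) 𝓘(ℝ, EuclideanSpace ℝ (Fin 3)) (ψ ∘ g) S z') :=
    mfderiv_comp_mfderivWithin z' hsymm (hchart.comp_mdifferentiableWithinAt z' hgz) hu
  have hα' : ∀ p q : M, p = q → (α p : EuclideanSpace ℝ (Fin 3) →L[ℝ] ℝ) = α q := by
    rintro p q rfl; rfl
  unfold pullForm inChart
  rw [← hcongr, hchain, mfderivWithin_eq_fderivWithin]
  exact congrArg (fun A : EuclideanSpace ℝ (Fin 3) →L[ℝ] ℝ => A.comp
    ((mfderiv 𝓘(ℝ, EuclideanSpace ℝ (Fin 3)) (𝓡 3) ψ.symm (ψ (g z'))).comp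
      (fderivWithin ℝ (ψ ∘ g) S z'))) (hα' _ _ (ψ.left_inv h1).symm)

omit [IsManifold (𝓡 3) ∞ M] in
theorem contDiffWithinAt_extChartAt_comp {S : Set F} {g : F → M}
    (hg : ContMDiffOn 𝓘(ℝ, F) (𝓡 3) ∞ g S) {z : F} (hz : z ∈ S) :
    ContDiffWithinAt ℝ ∞ (extChartAt (𝓡 3) (g z) ∘ g) S z :=
  ((contMDiffAt_extChartAt (I := 𝓡 3) (x := g z)).comp_contMDiffWithinAt z
    (hg z hz)).contDiffWithinAt

theorem contDiffOn_pullForm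
    (hα : ContMDiff (𝓡 3) ((𝓡 3).prod 𝓘(ℝ, EuclideanSpace ℝ (Fin 3) →L[ℝ] ℝ)) ∞
      (fun x => TotalSpace.mk' (EuclideanSpace ℝ (Fin 3) →L[ℝ] ℝ)
        (E := fun x : M => TangentSpace (𝓡 3) x →L[ℝ] ℝ) x (α x)))
    {S : Set F} (hS : UniqueDiffOn ℝ S) {g : F → M} (hg : ContMDiffOn 𝓘(ℝ, F) (𝓡 3) ∞ g S) :
    ContDiffOn ℝ ∞ (pullForm α S g) S := by
  intro z hz
  have hg' := contDiffWithinAt_extChartAt_comp hg hz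
  have h1 : ContDiffWithinAt ℝ ∞ (fun z' => (inChart α (g z) (extChartAt (𝓡 3) (g z) (g z'))).comp
      (fderivWithin ℝ (extChartAt (𝓡 3) (g z) ∘ g) S z')) S z :=
    ContDiffWithinAt.clm_comp
      (g := fun z' => inChart α (g z) (extChartAt (𝓡 3) (g z) (g z')))
      (ContDiffAt.comp_contDiffWithinAt (f := extChartAt (𝓡 3) (g z) ∘ g) z
        (contDiffAt_inChart hα (g z)) hg')
      (hg'.fderivWithin_right hS (by simp) hz)
  have h2 := inChart_comp_fderivWithin_eventuallyEq_pullForm (α := α) hS hg hz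
  exact h1.congr_of_eventuallyEq h2 (h2.self_of_nhdsWithin hz)

omit [IsManifold (𝓡 3) ∞ M] in
/-- The differential at `z`, computed in the preferred chart at `g z`. -/
theorem mfderivWithin_eq_fderivWithin_extChartAt_comp {S : Set F} {g : F → M}
    (hg : ContMDiffOn 𝓘(ℝ, F) (𝓡 3) ∞ g S) {z : F} (hz : z ∈ S) (v : F) :
    mfderivWithin 𝓘(ℝ, F) (𝓡 3) g S z v =
      fderivWithin ℝ (extChartAt (𝓡 3) (g z) ∘ g) S z v := by
  rw [((hg z hz).mdifferentiableWithinAt (n := ∞) (by simp)).mfderivWithin]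
  simp only [writtenInExtChartAt, mfld_simps]
  rfl

/-- The exterior derivative commutes with pullback: `d(g^*α) = g^*dα`. -/
theorem dForm_pullForm
    (hα : ContMDiff (𝓡 3) ((𝓡 3).prod 𝓘(ℝ, EuclideanSpace ℝ (Fin 3) →L[ℝ] ℝ)) ∞
      (fun x => TotalSpace.mk' (EuclideanSpace ℝ (Fin 3) →L[ℝ] ℝ)
        (E := fun x : M => TangentSpace (𝓡 3) x →L[ℝ] ℝ) x (α x)))
    {S : Set F} (hS : UniqueDiffOn ℝ S) (hS' : S ⊆ closure (interior S)) {g : F → M}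
    (hg : ContMDiffOn 𝓘(ℝ, F) (𝓡 3) ∞ g S) {z : F} (hz : z ∈ S) (v w : F) :
    dForm S (pullForm α S g) z v w =
      dAlpha α (g z) (mfderivWithin 𝓘(ℝ, F) (𝓡 3) g S z v)
        (mfderivWithin 𝓘(ℝ, F) (𝓡 3) g S z w) := by
  set ψ := extChartAt (𝓡 3) (g z) with hψ
  have hg' := contDiffWithinAt_extChartAt_comp hg hz
  have h2 := inChart_comp_fderivWithin_eventuallyEq_pullForm (α := α) hS hg hz
  rw [← hψ] at hg' h2
  have hA : HasFDerivAt (inChart α (g z)) (fderiv ℝ (inChart α (g z)) (ψ (g z))) (ψ (g z)) :=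
    ((contDiffAt_inChart hα (g z)).differentiableAt (by simp)).hasFDerivAt
  have hgd : HasFDerivWithinAt (ψ ∘ g) (fderivWithin ℝ (ψ ∘ g) S z) S z :=
    (hg'.differentiableWithinAt (by simp)).hasFDerivWithinAt
  have hgd2 : HasFDerivWithinAt (fderivWithin ℝ (ψ ∘ g) S)
      (fderivWithin ℝ (fderivWithin ℝ (ψ ∘ g) S) S z) S z :=
    ((hg'.fderivWithin_right (m := ∞) hS (by simp) hz).differentiableWithinAt
      (by simp)).hasFDerivWithinAt
  have hcomp := ((HasFDerivAt.comp_hasFDerivWithinAt z hA hgd).clm_comp hgd2).congr_of_eventuallyEq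
    h2 (h2.self_of_nhdsWithin hz)
  have hsymm := hg'.isSymmSndFDerivWithinAt
    (by simp only [minSmoothness_of_isRCLikeNormedField]; exact ENat.LEInfty.out) hS (hS' hz) hz
  have hopen : fderivWithin ℝ (inChart α (g z)) ψ.target (ψ (g z)) =
      fderiv ℝ (inChart α (g z)) (ψ (g z)) :=
    fderivWithin_of_mem_nhds
      ((isOpen_extChartAt_target (g z)).mem_nhds (mem_extChartAt_target (g z)))
  rw [mfderivWithin_eq_fderivWithin_extChartAt_comp hg hz,
    mfderivWithin_eq_fderivWithin_extChartAt_comp hg hz]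
  unfold dAlpha dForm
  rw [← hψ, hopen, hcomp.fderivWithin (hS z hz)]
  have hs : fderivWithin ℝ (fderivWithin ℝ (ψ ∘ g) S) S z v w =
    fderivWithin ℝ (fderivWithin ℝ (ψ ∘ g) S) S z w v := hsymm v w
  simp [hs]

end Pullback

/-! ### Smoothness of the Reeb vector field -/

section Reeb

variable {M : Type*} [TopologicalSpace M] [ChartedSpace (EuclideanSpace ℝ (Fin 3)) M]
  [IsManifold (𝓡 3) ∞ M] {α : (x : M) → TangentSpace (𝓡 3) x →L[ℝ] ℝ}

theorem dForm_inChart (hα : IsContactForm α) (x₀ : M) {y : EuclideanSpace ℝ (Fin 3)}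
    (hy : y ∈ (extChartAt (𝓡 3) x₀).target) (v w : EuclideanSpace ℝ (Fin 3)) :
    dForm (extChartAt (𝓡 3) x₀).target (inChart α x₀) y v w =
      dAlpha α ((extChartAt (𝓡 3) x₀).symm y)
        (mfderiv 𝓘(ℝ, EuclideanSpace ℝ (Fin 3)) (𝓡 3) (extChartAt (𝓡 3) x₀).symm y v)
        (mfderiv 𝓘(ℝ, EuclideanSpace ℝ (Fin 3)) (𝓡 3) (extChartAt (𝓡 3) x₀).symm y w) := by
  set ψ := extChartAt (𝓡 3) x₀ with hψ
  have ho : IsOpen ψ.target := isOpen_extChartAt_target x₀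
  have h := dForm_pullForm hα.smooth ho.uniqueDiffOn (by rw [ho.interior_eq]; exact subset_closure)
    (contMDiffOn_extChartAt_symm x₀) hy v w
  have hd : ∀ z ∈ ψ.target, mfderivWithin 𝓘(ℝ, EuclideanSpace ℝ (Fin 3)) (𝓡 3) ψ.symm ψ.target z =
      mfderiv 𝓘(ℝ, EuclideanSpace ℝ (Fin 3)) (𝓡 3) ψ.symm z := fun z hz =>
    mfderivWithin_of_isOpen ho hz
  rw [← hψ, hd y hy] at h
  rw [← h]
  have hev : inChart α x₀ =ᶠ[nhdsWithin y ψ.target] pullForm α ψ.target ψ.symm := by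
    filter_upwards [self_mem_nhdsWithin] with z hz
    unfold pullForm inChart
    rw [hd z hz]
  unfold dForm
  rw [hev.fderivWithin_eq (hev.self_of_nhdsWithin hy)]

/-- At every point of a contact manifold, a vector annihilated by `α` and by `dα` vanishes. -/
theorem eq_zero_of_dAlpha_eq_zero (hα : IsContactForm α) {x : M} {u : TangentSpace (𝓡 3) x}
    (h0 : α x u = 0) (h1 : ∀ w, dAlpha α x u w = 0) : u = 0 := by
  have hu := (exists_reeb hα x).unique (reeb_spec hα x) (y₂ := reeb α x + u)
    ⟨by rw [map_add, (reeb_spec hα x).1, h0, add_zero], fun w => by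
      have := dForm_add (E := EuclideanSpace ℝ (Fin 3)) (extChartAt (𝓡 3) x).target (inChart α x)
        (extChartAt (𝓡 3) x x) (reeb α x) u w
      refine this.trans ?_
      change dAlpha α x (reeb α x) w + dAlpha α x u w = 0
      rw [(reeb_spec hα x).2 w, h1 w, add_zero]⟩
  simpa using hu

theorem contDiffAt_smulRight_add_sub_flip {G : Type*} [NormedAddCommGroup G] [NormedSpace ℝ G]
    [FiniteDimensional ℝ G] {A : G → G →L[ℝ] ℝ} {D : G → G →L[ℝ] G →L[ℝ] ℝ} {y : G}
    (hA : ContDiffAt ℝ ∞ A y) (hD : ContDiffAt ℝ ∞ D y) :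
    ContDiffAt ℝ ∞ (fun y => (A y).smulRight (A y) + (D y - (D y).flip)) y := by
  have h2 : ContDiff ℝ ∞ (fun B : G →L[ℝ] G →L[ℝ] ℝ => B.flip) :=
    contDiff_clm_apply_iff.2 fun v => contDiff_clm_apply_iff.2 fun w =>
      (contDiff_id.clm_apply contDiff_const).clm_apply contDiff_const
  exact (hA.smulRight hA).add (hD.sub (h2.contDiffAt.comp y hD))

/-- In a chart, `X = L⁻¹ α` for the invertible linear map `L v = α(v) α + dα(v, ·)`, so that the
Reeb vector field is as smooth as `α`. -/
theorem contMDiff_reeb (hα : IsContactForm α) :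
    ContMDiff (𝓡 3) (𝓡 3).tangent ∞ (fun x => (⟨x, reeb α x⟩ : TangentBundle (𝓡 3) M)) := by
  intro x₀
  rw [contMDiffAt_section]
  set ψ := extChartAt (𝓡 3) x₀ with hψ
  let e := trivializationAt (EuclideanSpace ℝ (Fin 3)) (TangentSpace (M := M) (𝓡 3)) x₀
  have ho : IsOpen ψ.target := isOpen_extChartAt_target x₀
  let A := inChart α x₀
  let L : EuclideanSpace ℝ (Fin 3) →
      EuclideanSpace ℝ (Fin 3) →L[ℝ] EuclideanSpace ℝ (Fin 3) →L[ℝ] ℝ :=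
    fun y => (A y).smulRight (A y) + (fderiv ℝ A y - (fderiv ℝ A y).flip)
  have hL : ∀ y ∈ ψ.target, ∀ v w, L y v w = A y v * A y w + dForm ψ.target A y v w := by
    intro y hy v w
    have : fderivWithin ℝ A ψ.target y = fderiv ℝ A y := fderivWithin_of_isOpen ho hy
    simp [L, dForm, this]
  have hAX : ∀ y ∈ ψ.target, L y (e ⟨ψ.symm y, reeb α (ψ.symm y)⟩).2 = A y := by
    intro y hy
    have hs : ψ.symm y ∈ (chartAt (EuclideanSpace ℝ (Fin 3)) x₀).source := by
      simpa [hψ] using ψ.map_target hy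
    have h1 := mfderiv_extChartAt_symm_trivializationAt hs (reeb α (ψ.symm y))
    rw [← hψ, ψ.right_inv hy] at h1
    ext w
    rw [hL y hy, dForm_inChart hα x₀ hy, ← hψ]
    have h2 : A y (e ⟨ψ.symm y, reeb α (ψ.symm y)⟩).2 = 1 :=
      (congrArg (α (ψ.symm y)) h1).trans (reeb_spec hα _).1
    rw [h2, one_mul]
    refine (add_eq_left).2 ?_
    refine Eq.trans ?_ ((reeb_spec hα (ψ.symm y)).2
      (mfderiv 𝓘(ℝ, EuclideanSpace ℝ (Fin 3)) (𝓡 3) ψ.symm y w))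
    exact congrArg (fun u => dAlpha α (ψ.symm y) u _) h1
  have hinj : Function.Injective (L (ψ x₀)) := by
    have hy : ψ x₀ ∈ ψ.target := mem_extChartAt_target x₀
    rw [injective_iff_map_eq_zero]
    intro v hv
    have h0 : A (ψ x₀) v = 0 := by
      have := hL _ hy v v
      rw [hv] at this
      simpa [dForm] using this
    have h1 : ∀ w, dForm ψ.target A (ψ x₀) v w = 0 := fun w => by
      have := hL _ hy v w
      rw [hv, h0] at this
      simpa using this.symm
    obtain ⟨T, hT⟩ := isInvertible_mfderivWithin_extChartAt_symm (I := 𝓡 3) (x := x₀) hy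
    rw [modelWithCornersSelf_coe, range_id, mfderivWithin_univ, ← hψ] at hT
    have h2 : T v = 0 := by
      refine eq_zero_of_dAlpha_eq_zero hα ?_ fun w => ?_
      · have : T v = mfderiv 𝓘(ℝ, EuclideanSpace ℝ (Fin 3)) (𝓡 3) ψ.symm (ψ x₀) v := by
          rw [← hT]; rfl
        rw [this]
        exact h0
      · have h3 := (dForm_inChart hα x₀ hy v (T.symm w)).symm.trans (h1 _)
        rw [← hψ, ← hT] at h3
        have h4 : T (T.symm w) = w := T.apply_symm_apply w
        refine Eq.trans ?_ h3
        exact congrArg (dAlpha α _ (T v)) h4.symm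
    exact T.injective (h2.trans (map_zero T).symm)
  have hfin : Module.finrank ℝ (EuclideanSpace ℝ (Fin 3)) =
      Module.finrank ℝ (EuclideanSpace ℝ (Fin 3) →L[ℝ] ℝ) := by
    rw [← (LinearMap.toContinuousLinearMap (𝕜 := ℝ) (E := EuclideanSpace ℝ (Fin 3))
      (F' := ℝ)).finrank_eq]
    exact Subspace.dual_finrank_eq.symm
  let Le := (LinearMap.linearEquivOfInjective (L (ψ x₀)).toLinearMap hinj
    hfin).toContinuousLinearEquiv
  have hLe : (Le : EuclideanSpace ℝ (Fin 3) →L[ℝ] EuclideanSpace ℝ (Fin 3) →L[ℝ] ℝ) =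
      L (ψ x₀) := by ext; rfl
  have hAs : ContDiffAt ℝ ∞ A (ψ x₀) := contDiffAt_inChart hα.smooth x₀
  have hA's : ContDiffAt ℝ ∞ (fderiv ℝ A) (ψ x₀) := hAs.fderiv_right (by simp)
  have hLs : ContDiffAt ℝ ∞ L (ψ x₀) :=
    contDiffAt_smulRight_add_sub_flip hAs hA's
  have hinv : ContDiffAt ℝ ∞ (fun y => (L y).inverse (A y)) (ψ x₀) := by
    have h1 : ContDiffAt ℝ ∞ (ContinuousLinearMap.inverse (R := ℝ)
        (M := EuclideanSpace ℝ (Fin 3)) (M₂ := EuclideanSpace ℝ (Fin 3) →L[ℝ] ℝ)) (L (ψ x₀)) := by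
      rw [← hLe]; exact contDiffAt_map_inverse Le
    exact (h1.comp (ψ x₀) hLs).clm_apply hAs
  have hψs : ContMDiffAt (𝓡 3) 𝓘(ℝ, EuclideanSpace ℝ (Fin 3)) ∞ ψ x₀ := contMDiffAt_extChartAt
  refine (hinv.contMDiffAt.comp x₀ hψs).congr_of_eventuallyEq ?_
  have hunit : ∀ᶠ y in nhds (ψ x₀), ∃ T : EuclideanSpace ℝ (Fin 3) ≃L[ℝ]
      (EuclideanSpace ℝ (Fin 3) →L[ℝ] ℝ), (T : _ →L[ℝ] _) = L y := by
    refine hLs.continuousAt.eventually (p := fun B => ∃ T : EuclideanSpace ℝ (Fin 3) ≃L[ℝ]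
      (EuclideanSpace ℝ (Fin 3) →L[ℝ] ℝ), (T : _ →L[ℝ] _) = B) ?_
    rw [← hLe]
    exact ContinuousLinearEquiv.nhds Le
  filter_upwards [hψs.continuousAt.eventually hunit,
    extChartAt_source_mem_nhds (I := 𝓡 3) x₀] with x ⟨T, hT⟩ hx
  have h1 := hAX (ψ x) (ψ.map_source hx)
  rw [ψ.left_inv hx, ← hT] at h1
  simp only [Function.comp_apply]
  rw [← hT, ContinuousLinearMap.inverse_equiv, ← h1]
  exact (T.symm_apply_apply _).symm

end Reeb

/-! ### The Reeb flow -/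

section ReebFlow

variable {M : Type*} [TopologicalSpace M] [T2Space M] [CompactSpace M]
  [ChartedSpace (EuclideanSpace ℝ (Fin 3)) M]
  [IsManifold (𝓡 3) ∞ M] {α : (x : M) → TangentSpace (𝓡 3) x →L[ℝ] ℝ}

theorem reebFlow_spec (hα : IsContactForm α) (x : M) :
    reebFlow α 0 x = x ∧
      IsMIntegralCurve (I := 𝓡 3) (fun t => reebFlow α t x) (reeb α) := by
  have h := exists_isMIntegralCurve_of_compactSpace (contMDiff_reeb hα) x
  have hc : (fun t => reebFlow α t x) = h.choose := by
    funext t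
    rw [reebFlow, dif_pos h]
  have h0 : reebFlow α 0 x = h.choose 0 := congrFun hc 0
  rw [hc, h0]
  exact h.choose_spec

theorem reebFlow_zero (hα : IsContactForm α) (x : M) : reebFlow α 0 x = x :=
  (reebFlow_spec hα x).1

theorem contMDiff_uncurry_reebFlow (hα : IsContactForm α) :
    ContMDiff (𝓘(ℝ, ℝ).prod (𝓡 3)) (𝓡 3) ∞ (fun p : ℝ × M => reebFlow α p.1 p.2) :=
  contMDiff_flow (contMDiff_reeb hα) (fun x => (reebFlow_spec hα x).1)
    (fun x => (reebFlow_spec hα x).2)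

theorem reebFlow_add (hα : IsContactForm α) (s t : ℝ) (x : M) :
    reebFlow α (s + t) x = reebFlow α s (reebFlow α t x) :=
  flow_add_of_isMIntegralCurve (contMDiff_reeb hα) (fun x => (reebFlow_spec hα x).1)
    (fun x => (reebFlow_spec hα x).2) s t x

theorem reebFlow_reebFlow_neg (hα : IsContactForm α) (t : ℝ) (x : M) :
    reebFlow α t (reebFlow α (-t) x) = x := by
  rw [← reebFlow_add hα, add_neg_cancel, reebFlow_zero hα]

theorem contMDiff_reebFlow (hα : IsContactForm α) (t : ℝ) :
    ContMDiff (𝓡 3) (𝓡 3) ∞ (reebFlow α t : M → M) :=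
  (contMDiff_uncurry_reebFlow hα).comp (contMDiff_const.prodMk contMDiff_id)

/-- The differential `dφ_t(x)` of the Reeb flow, as an endomorphism of the model space. All tangent
spaces are identified with the model space, which makes composition of differentials at points that
are only propositionally equal possible. -/
noncomputable def flowDeriv (α : (x : M) → TangentSpace (𝓡 3) x →L[ℝ] ℝ) (t : ℝ) (x : M) :
    EuclideanSpace ℝ (Fin 3) →L[ℝ] EuclideanSpace ℝ (Fin 3) :=
  mfderiv (𝓡 3) (𝓡 3) (reebFlow α t) x

theorem hasMFDerivAt_reebFlow (hα : IsContactForm α) (t : ℝ) (x : M) :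
    HasMFDerivAt (𝓡 3) (𝓡 3) (reebFlow α t) x (flowDeriv α t x) :=
  ((contMDiff_reebFlow hα t).mdifferentiable (by simp) x).hasMFDerivAt

theorem flowDeriv_zero (hα : IsContactForm α) (x : M) :
    flowDeriv α 0 x = ContinuousLinearMap.id ℝ _ := by
  have h : (reebFlow α 0 : M → M) = id := funext (reebFlow_zero hα)
  unfold flowDeriv
  rw [h]
  exact mfderiv_id

theorem flowDeriv_add (hα : IsContactForm α) (s t : ℝ) (x : M) :
    flowDeriv α (s + t) x = (flowDeriv α s (reebFlow α t x)).comp (flowDeriv α t x) := by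
  have h : (reebFlow α (s + t) : M → M) = reebFlow α s ∘ reebFlow α t :=
    funext (reebFlow_add hα s t)
  have h1 := HasMFDerivAt.comp x (hasMFDerivAt_reebFlow hα s (reebFlow α t x))
    (hasMFDerivAt_reebFlow hα t x)
  rw [← h] at h1
  exact h1.mfderiv

theorem flowDeriv_comp_flowDeriv_neg (hα : IsContactForm α) (t : ℝ) (x : M) :
    (flowDeriv α t (reebFlow α (-t) x)).comp (flowDeriv α (-t) x) =
      ContinuousLinearMap.id ℝ _ := by
  rw [← flowDeriv_add hα, add_neg_cancel, flowDeriv_zero hα]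

theorem flowDeriv_neg_comp_flowDeriv (hα : IsContactForm α) (t : ℝ) (x : M) :
    (flowDeriv α (-t) x).comp (flowDeriv α t (reebFlow α (-t) x)) =
      ContinuousLinearMap.id ℝ _ := by
  have h := flowDeriv_add hα (-t) t (reebFlow α (-t) x)
  rw [reebFlow_reebFlow_neg hα, neg_add_cancel, flowDeriv_zero hα] at h
  exact h.symm

/-- The Reeb vector field, with all tangent spaces identified with the model space. -/
noncomputable def reebVec (α : (x : M) → TangentSpace (𝓡 3) x →L[ℝ] ℝ) (x : M) :
    EuclideanSpace ℝ (Fin 3) :=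
  reeb α x

theorem hasMFDerivAt_reebFlow_time (hα : IsContactForm α) (t : ℝ) (x : M) :
    HasMFDerivAt 𝓘(ℝ, ℝ) (𝓡 3) (fun t => reebFlow α t x) t
      ((1 : ℝ →L[ℝ] ℝ).smulRight (reeb α (reebFlow α t x))) :=
  (reebFlow_spec hα x).2 t

theorem flowDeriv_reeb (hα : IsContactForm α) (t : ℝ) (x : M) :
    flowDeriv α t x (reeb α x) = reeb α (reebFlow α t x) := by
  have h1 : HasMFDerivAt 𝓘(ℝ, ℝ) (𝓡 3) (fun s => reebFlow α t (reebFlow α s x)) 0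
      ((flowDeriv α t (reebFlow α 0 x)).comp
        ((1 : ℝ →L[ℝ] ℝ).smulRight (reeb α (reebFlow α 0 x) : EuclideanSpace ℝ (Fin 3)))) :=
    HasMFDerivAt.comp (0 : ℝ) (hasMFDerivAt_reebFlow hα t (reebFlow α 0 x))
      (hasMFDerivAt_reebFlow_time hα 0 x)
  have h2 := hasMFDerivAt_reebFlow_time hα 0 (reebFlow α t x)
  have hcomm : (fun s => reebFlow α t (reebFlow α s x)) =
      fun s => reebFlow α s (reebFlow α t x) := by
    funext s
    rw [← reebFlow_add hα, ← reebFlow_add hα, add_comm]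
  rw [hcomm] at h1
  have h3 := hasMFDerivAt_unique h1 h2
  have h4 := congrArg (fun A : ℝ →L[ℝ] EuclideanSpace ℝ (Fin 3) => A 1) h3
  have hr : ∀ p q : M, p = q → (reeb α p : EuclideanSpace ℝ (Fin 3)) = reeb α q := by
    rintro p _ rfl; rfl
  have h5 : flowDeriv α t (reebFlow α 0 x) ((1 : ℝ) • (reeb α (reebFlow α 0 x) :
      EuclideanSpace ℝ (Fin 3))) = (1 : ℝ) • (reeb α (reebFlow α 0 (reebFlow α t x)) :
      EuclideanSpace ℝ (Fin 3)) := h4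
  rw [one_smul, one_smul, reebFlow_zero hα, hr _ _ (reebFlow_zero hα _)] at h5
  exact h5

theorem hasMFDerivAt_uncurry_reebFlow (hα : IsContactForm α) (p : ℝ × M) :
    HasMFDerivAt (𝓘(ℝ, ℝ).prod (𝓡 3)) (𝓡 3) (fun p : ℝ × M => reebFlow α p.1 p.2) p
      ((ContinuousLinearMap.fst ℝ ℝ (EuclideanSpace ℝ (Fin 3))).smulRight
          (reebVec α (reebFlow α p.1 p.2)) +
        (flowDeriv α p.1 p.2).comp (ContinuousLinearMap.snd ℝ ℝ (EuclideanSpace ℝ (Fin 3)))) := by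
  have hd : MDifferentiableAt (𝓘(ℝ, ℝ).prod (𝓡 3)) (𝓡 3)
      (fun p : ℝ × M => reebFlow α p.1 p.2) p :=
    (contMDiff_uncurry_reebFlow hα).mdifferentiable (by simp) p
  refine hd.hasMFDerivAt.congr_mfderiv ?_
  refine ContinuousLinearMap.ext fun v => ?_
  refine (mfderiv_prod_eq_add_apply hd).trans ?_
  rw [(hasMFDerivAt_reebFlow_time hα p.1 p.2).mfderiv]
  rfl

/-- The differential of `z ↦ φ_{τ(z)}(g z)`. -/
theorem mfderivWithin_reebFlow_comp (hα : IsContactForm α) {F : Type*} [NormedAddCommGroup F]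
    [NormedSpace ℝ F] {S : Set F} (hS : UniqueDiffOn ℝ S) {g : F → M}
    (hg : ContMDiffOn 𝓘(ℝ, F) (𝓡 3) ∞ g S) (τ : F →L[ℝ] ℝ) {z : F} (hz : z ∈ S) (v : F) :
    mfderivWithin 𝓘(ℝ, F) (𝓡 3) (fun z => reebFlow α (τ z) (g z)) S z v =
      τ v • reebVec α (reebFlow α (τ z) (g z)) +
        flowDeriv α (τ z) (g z) (mfderivWithin 𝓘(ℝ, F) (𝓡 3) g S z v) := by
  have h1 : HasMFDerivWithinAt 𝓘(ℝ, F) 𝓘(ℝ, ℝ) τ S z τ :=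
    τ.hasFDerivAt.hasMFDerivAt.hasMFDerivWithinAt
  have h2 : HasMFDerivWithinAt 𝓘(ℝ, F) (𝓡 3) g S z (mfderivWithin 𝓘(ℝ, F) (𝓡 3) g S z) :=
    ((hg z hz).mdifferentiableWithinAt (by simp)).hasMFDerivWithinAt
  have h3 := HasMFDerivAt.comp_hasMFDerivWithinAt z
    (hasMFDerivAt_uncurry_reebFlow hα (τ z, g z)) (h1.prodMk h2)
  have h4 : mfderivWithin 𝓘(ℝ, F) (𝓡 3) (fun z => reebFlow α (τ z) (g z)) S z = _ :=
    h3.mfderivWithin (hS z hz).uniqueMDiffWithinAt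
  rw [h4]
  rfl

theorem contMDiffOn_reebFlow_comp (hα : IsContactForm α) {F : Type*} [NormedAddCommGroup F]
    [NormedSpace ℝ F] {S : Set F} {g : F → M} (hg : ContMDiffOn 𝓘(ℝ, F) (𝓡 3) ∞ g S)
    (τ : F →L[ℝ] ℝ) : ContMDiffOn 𝓘(ℝ, F) (𝓡 3) ∞ (fun z => reebFlow α (τ z) (g z)) S :=
  (contMDiff_uncurry_reebFlow hα).comp_contMDiffOn
    (τ.contDiff.contMDiff.contMDiffOn.prodMk hg)


/-- The Reeb flow preserves the contact form. In a chart, `η = Φ^*α` for `Φ(t, y) = φ_t(y)`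
satisfies `η(∂_t) = 1` and `dη(∂_t, ·) = 0`, so that the coefficients of `η` do not depend on
`t`. -/
theorem apply_flowDeriv (hα : IsContactForm α) (t : ℝ) (x : M) (v : EuclideanSpace ℝ (Fin 3)) :
    α (reebFlow α t x) (flowDeriv α t x v) = α x v := by
  set ψ := extChartAt (𝓡 3) x with hψ
  have hψo : IsOpen ψ.target := isOpen_extChartAt_target x
  set S : Set (ℝ × EuclideanSpace ℝ (Fin 3)) := univ ×ˢ ψ.target with hS
  have hSo : IsOpen S := isOpen_univ.prod hψo
  set g : ℝ × EuclideanSpace ℝ (Fin 3) → M := fun z => ψ.symm z.2 with hg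
  have hgs : ContMDiffOn 𝓘(ℝ, ℝ × EuclideanSpace ℝ (Fin 3)) (𝓡 3) ∞ g S :=
    (contMDiffOn_extChartAt_symm x).comp contDiff_snd.contMDiff.contMDiffOn (fun z hz => hz.2)
  set τ := ContinuousLinearMap.fst ℝ ℝ (EuclideanSpace ℝ (Fin 3)) with hτ
  set Φ : ℝ × EuclideanSpace ℝ (Fin 3) → M := fun z => reebFlow α (τ z) (g z) with hΦ
  have hΦs : ContMDiffOn 𝓘(ℝ, ℝ × EuclideanSpace ℝ (Fin 3)) (𝓡 3) ∞ Φ S :=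
    contMDiffOn_reebFlow_comp hα hgs τ
  have hDg : ∀ z ∈ S, ∀ w : ℝ × EuclideanSpace ℝ (Fin 3),
      mfderivWithin 𝓘(ℝ, ℝ × EuclideanSpace ℝ (Fin 3)) (𝓡 3) g S z w =
        mfderiv 𝓘(ℝ, EuclideanSpace ℝ (Fin 3)) (𝓡 3) ψ.symm z.2 w.2 := by
    intro z hz w
    have h1 : MDifferentiableAt 𝓘(ℝ, EuclideanSpace ℝ (Fin 3)) (𝓡 3) ψ.symm z.2 :=
      ((contMDiffOn_extChartAt_symm (n := ∞) x).contMDiffAt (hψo.mem_nhds hz.2)).mdifferentiableAt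
        (by simp)
    have h2 : HasMFDerivWithinAt 𝓘(ℝ, ℝ × EuclideanSpace ℝ (Fin 3))
        𝓘(ℝ, EuclideanSpace ℝ (Fin 3)) Prod.snd S z
        (ContinuousLinearMap.snd ℝ ℝ (EuclideanSpace ℝ (Fin 3))) :=
      hasFDerivAt_snd.hasMFDerivAt.hasMFDerivWithinAt
    have h3 := (HasMFDerivAt.comp_hasMFDerivWithinAt z h1.hasMFDerivAt h2).mfderivWithin
      (hSo.uniqueDiffOn z hz).uniqueMDiffWithinAt
    exact congrArg (fun A : ℝ × EuclideanSpace ℝ (Fin 3) →L[ℝ] EuclideanSpace ℝ (Fin 3) => A w) h3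
  set η := pullForm α S Φ with hη
  have hηs : ContDiffOn ℝ ∞ η S := contDiffOn_pullForm hα.smooth hSo.uniqueDiffOn hΦs
  have hDΦ : ∀ z ∈ S, ∀ w, mfderivWithin 𝓘(ℝ, ℝ × EuclideanSpace ℝ (Fin 3)) (𝓡 3) Φ S z w =
      w.1 • reebVec α (Φ z) + flowDeriv α z.1 (g z)
        (mfderiv 𝓘(ℝ, EuclideanSpace ℝ (Fin 3)) (𝓡 3) ψ.symm z.2 w.2) := by
    intro z hz w
    have h := mfderivWithin_reebFlow_comp hα hSo.uniqueDiffOn hgs τ hz w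
    refine h.trans ?_
    exact congrArg (fun p : EuclideanSpace ℝ (Fin 3) =>
      w.1 • reebVec α (Φ z) + flowDeriv α z.1 (g z) p) (hDg z hz w)
  have hDΦ1 : ∀ z ∈ S, mfderivWithin 𝓘(ℝ, ℝ × EuclideanSpace ℝ (Fin 3)) (𝓡 3) Φ S z
      ((1, 0) : ℝ × EuclideanSpace ℝ (Fin 3)) = reebVec α (Φ z) := by
    intro z hz
    refine (hDΦ z hz (1, 0)).trans ?_
    have h0 : mfderiv 𝓘(ℝ, EuclideanSpace ℝ (Fin 3)) (𝓡 3) ψ.symm z.2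
      (0 : EuclideanSpace ℝ (Fin 3)) = (0 : EuclideanSpace ℝ (Fin 3)) := map_zero _
    simp only [h0, map_zero, one_smul, add_zero]
    rfl
  have hDΦ2 : ∀ z ∈ S, ∀ w : EuclideanSpace ℝ (Fin 3),
      mfderivWithin 𝓘(ℝ, ℝ × EuclideanSpace ℝ (Fin 3)) (𝓡 3) Φ S z
      ((0, w) : ℝ × EuclideanSpace ℝ (Fin 3)) = flowDeriv α z.1 (g z)
        (mfderiv 𝓘(ℝ, EuclideanSpace ℝ (Fin 3)) (𝓡 3) ψ.symm z.2 w) := by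
    intro z hz w
    refine (hDΦ z hz (0, w)).trans ?_
    simp only [zero_smul, zero_add]
    rfl
  have hη1 : ∀ z ∈ S, η z (1, 0) = 1 := fun z hz =>
    (congrArg (α (Φ z)) (hDΦ1 z hz)).trans (reeb_spec hα (Φ z)).1
  have hηd : ∀ z ∈ S, HasFDerivAt η (fderivWithin ℝ η S z) z := fun z hz =>
    ((hηs z hz).differentiableWithinAt (by simp)).hasFDerivWithinAt.hasFDerivAt (hSo.mem_nhds hz)
  have hzero : ∀ z ∈ S, ∀ w : EuclideanSpace ℝ (Fin 3),
      fderivWithin ℝ η S z (1, 0) (0, w) = 0 := by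
    intro z hz w
    have h1 := dForm_pullForm hα.smooth hSo.uniqueDiffOn
      (by rw [hSo.interior_eq]; exact subset_closure) hΦs hz (1, 0) (0, w)
    have h2 : dAlpha α (Φ z)
        (mfderivWithin 𝓘(ℝ, ℝ × EuclideanSpace ℝ (Fin 3)) (𝓡 3) Φ S z
          ((1, 0) : ℝ × EuclideanSpace ℝ (Fin 3)))
        (mfderivWithin 𝓘(ℝ, ℝ × EuclideanSpace ℝ (Fin 3)) (𝓡 3) Φ S z
          ((0, w) : ℝ × EuclideanSpace ℝ (Fin 3))) = 0 :=
      (congrArg (fun p => dAlpha α (Φ z) p _) (hDΦ1 z hz)).trans ((reeb_spec hα (Φ z)).2 _)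
    -- the other term of `dη(∂_t, ∂_w)` is the derivative of the constant function `η(∂_t)`
    have h3 : fderivWithin ℝ η S z (0, w) (1, 0) = 0 := by
      have h4 : HasFDerivAt (fun z => η z (1, 0)) ((fderivWithin ℝ η S z).flip (1, 0)) z := by
        simpa using (hηd z hz).clm_apply (hasFDerivAt_const (1, 0) z)
      have h5 : HasFDerivAt (fun z => η z (1, 0))
          (0 : ℝ × EuclideanSpace ℝ (Fin 3) →L[ℝ] ℝ) z :=
        (hasFDerivAt_const (1 : ℝ) z).congr_of_eventuallyEq (by
          filter_upwards [hSo.mem_nhds hz] with y hy using hη1 y hy)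
      have h6 := congrArg (fun A : ℝ × EuclideanSpace ℝ (Fin 3) →L[ℝ] ℝ => A (0, w)) (h4.unique h5)
      simpa using h6
    have h7 := h1.trans h2
    simp only [dForm, ← hη, h3, sub_zero] at h7
    exact h7
  have hx : ψ x ∈ ψ.target := mem_extChartAt_target x
  have hconst : ∀ w : EuclideanSpace ℝ (Fin 3), η (t, ψ x) (0, w) = η (0, ψ x) (0, w) := by
    intro w
    have hd : ∀ s : ℝ, HasDerivAt (fun s : ℝ => η (s, ψ x) (0, w)) 0 s := by
      intro s
      have hs : (s, ψ x) ∈ S := ⟨mem_univ _, hx⟩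
      have h1 : HasDerivAt (fun s : ℝ => (s, ψ x)) ((1 : ℝ), (0 : EuclideanSpace ℝ (Fin 3))) s :=
        (hasDerivAt_id s).prodMk (hasDerivAt_const s (ψ x))
      have h2 := (hηd _ hs).comp_hasDerivAt s h1
      have h3 := h2.clm_apply (hasDerivAt_const s ((0 : ℝ), w))
      simpa [hzero _ hs w] using h3
    exact is_const_of_deriv_eq_zero (fun s => (hd s).differentiableAt) (fun s => (hd s).deriv) t 0
  set B : EuclideanSpace ℝ (Fin 3) →L[ℝ] EuclideanSpace ℝ (Fin 3) := mfderiv (𝓡 3)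
    𝓘(ℝ, EuclideanSpace ℝ (Fin 3)) ψ x with hB
  have hBv : mfderiv 𝓘(ℝ, EuclideanSpace ℝ (Fin 3)) (𝓡 3) ψ.symm (ψ x) (B v) = v := by
    have h := mfderivWithin_extChartAt_symm_comp_mfderiv_extChartAt' (I := 𝓡 3) (x := x)
      (mem_extChartAt_source x)
    rw [modelWithCornersSelf_coe, range_id, mfderivWithin_univ] at h
    exact congrArg (fun A : EuclideanSpace ℝ (Fin 3) →L[ℝ] EuclideanSpace ℝ (Fin 3) => A v) h
  have hgx : ∀ s : ℝ, g (s, ψ x) = x := fun s => ψ.left_inv (mem_extChartAt_source x)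
  have hval : ∀ s : ℝ, η (s, ψ x) (0, B v) = α (reebFlow α s x) (flowDeriv α s x v) := by
    intro s
    refine (congrArg (α (Φ (s, ψ x))) (hDΦ2 (s, ψ x) ⟨mem_univ _, hx⟩ (B v))).trans ?_
    have hcongr : ∀ p q : M, p = q → ∀ b c : EuclideanSpace ℝ (Fin 3), b = c →
        α (reebFlow α s p) (flowDeriv α s p b) = α (reebFlow α s q) (flowDeriv α s q c) := by
      rintro p _ rfl b _ rfl; rfl
    exact hcongr _ _ (hgx s) _ _ hBv
  rw [← hval, hconst, hval, flowDeriv_zero hα]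
  have hcongr : ∀ p q : M, p = q → ∀ b : EuclideanSpace ℝ (Fin 3), α p b = α q b := by
    rintro p _ rfl b; rfl
  exact hcongr _ _ (reebFlow_zero hα x) v

end ReebFlow

/-! ### Transport of the complex structure by the Reeb flow -/

/-- Reading fields of linear maps between tangent spaces in coordinates is compatible with
composition, as the coordinates at the middle point cancel. -/
theorem inTangentCoordinates_comp {E : Type*} [NormedAddCommGroup E] [NormedSpace ℝ E]
    {M N : Type*} [TopologicalSpace M] [ChartedSpace E M] [IsManifold 𝓘(ℝ, E) 1 M]
    (f g h : N → M) (A B : N → E →L[ℝ] E) {x₀ x : N} (hx : g x ∈ (chartAt E (g x₀)).source) :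
    (inTangentCoordinates 𝓘(ℝ, E) 𝓘(ℝ, E) g h B x₀ x).comp
        (inTangentCoordinates 𝓘(ℝ, E) 𝓘(ℝ, E) f g A x₀ x) =
      inTangentCoordinates 𝓘(ℝ, E) 𝓘(ℝ, E) f h (fun y => (B y).comp (A y)) x₀ x := by
  refine ContinuousLinearMap.ext fun v => ?_
  have hx' : g x ∈ (trivializationAt E (TangentSpace 𝓘(ℝ, E)) (g x₀)).baseSet := hx
  have h := (trivializationAt E (TangentSpace 𝓘(ℝ, E)) (g x₀)).symmL_continuousLinearMapAt (R := ℝ)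
    hx' (A x ((trivializationAt E (TangentSpace 𝓘(ℝ, E)) (f x₀)).symmL ℝ (f x) v))
  exact congrArg (fun w : E =>
    (trivializationAt E (TangentSpace 𝓘(ℝ, E)) (_ : M)).continuousLinearMapAt ℝ _ (B x w)) h

section Transport

variable {M : Type*} [TopologicalSpace M] [T2Space M] [CompactSpace M]
  [ChartedSpace (EuclideanSpace ℝ (Fin 3)) M]
  [IsManifold (𝓡 3) ∞ M] {α : (x : M) → TangentSpace (𝓡 3) x →L[ℝ] ℝ}
  {J : (x : M) → TangentSpace (𝓡 3) x →L[ℝ] TangentSpace (𝓡 3) x}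

/-- A field of endomorphisms, with all tangent spaces identified with the model space. -/
noncomputable def endoVec (J : (x : M) → TangentSpace (𝓡 3) x →L[ℝ] TangentSpace (𝓡 3) x) (x : M) :
    EuclideanSpace ℝ (Fin 3) →L[ℝ] EuclideanSpace ℝ (Fin 3) :=
  J x

omit [T2Space M] [CompactSpace M] [IsManifold (𝓡 3) ∞ M] in
theorem endoVec_transport (ρ : ℝ) (x : M) :
    endoVec (transport α J ρ) x = ((flowDeriv α ρ (reebFlow α (-ρ) x)).comp
      (endoVec J (reebFlow α (-ρ) x))).comp (flowDeriv α (-ρ) x) :=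
  rfl

theorem contMDiff_transport (hα : IsContactForm α) (hJ : IsComplexStructure α J) (ρ : ℝ) :
    ContMDiff (𝓡 3)
      ((𝓡 3).prod 𝓘(ℝ, EuclideanSpace ℝ (Fin 3) →L[ℝ] EuclideanSpace ℝ (Fin 3))) ∞
      (fun x => TotalSpace.mk' (EuclideanSpace ℝ (Fin 3) →L[ℝ] EuclideanSpace ℝ (Fin 3))
        (E := fun x : M => TangentSpace (𝓡 3) x →L[ℝ] TangentSpace (𝓡 3) x) x
          (transport α J ρ x)) := by
  intro x₀
  refine (contMDiffAt_hom_bundle _).2 ⟨contMDiffAt_id, ?_⟩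
  change ContMDiffAt (𝓡 3) 𝓘(ℝ, EuclideanSpace ℝ (Fin 3) →L[ℝ] EuclideanSpace ℝ (Fin 3)) ∞
    (inTangentCoordinates (𝓡 3) (𝓡 3) id id (endoVec (transport α J ρ)) x₀) x₀
  set g : M → M := reebFlow α (-ρ) with hg
  have hgs : ContMDiff (𝓡 3) (𝓡 3) ∞ g := contMDiff_reebFlow hα (-ρ)
  have hid : (fun x => reebFlow α ρ (g x)) = id := funext (reebFlow_reebFlow_neg hα ρ)
  have h1 : ContMDiffAt (𝓡 3) 𝓘(ℝ, EuclideanSpace ℝ (Fin 3) →L[ℝ] EuclideanSpace ℝ (Fin 3)) ∞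
      (inTangentCoordinates (𝓡 3) (𝓡 3) id g (flowDeriv α (-ρ)) x₀) x₀ :=
    (hgs x₀).mfderiv_const (m := ∞) (n := ∞) (by simp)
  have h3 : ContMDiffAt (𝓡 3) 𝓘(ℝ, EuclideanSpace ℝ (Fin 3) →L[ℝ] EuclideanSpace ℝ (Fin 3)) ∞
      (inTangentCoordinates (𝓡 3) (𝓡 3) g (fun x => reebFlow α ρ (g x))
        (fun x => flowDeriv α ρ (g x)) x₀) x₀ :=
    ContMDiffAt.mfderiv (m := ∞) (n := ∞) (fun _ => reebFlow α ρ) g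
      (((contMDiff_reebFlow hα ρ).comp contMDiff_snd) _) (hgs x₀) (by simp)
  rw [hid] at h3
  have h2 : ContMDiffAt (𝓡 3) 𝓘(ℝ, EuclideanSpace ℝ (Fin 3) →L[ℝ] EuclideanSpace ℝ (Fin 3)) ∞
      (inTangentCoordinates (𝓡 3) (𝓡 3) g g (fun x => endoVec J (g x)) x₀) x₀ :=
    ContMDiffAt.comp x₀ ((contMDiffAt_hom_bundle _).1 (hJ.smooth (g x₀))).2 (hgs x₀)
  refine (ContMDiffAt.clm_comp (h3.clm_comp h2) h1).congr_of_eventuallyEq ?_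
  have hsrc : ∀ᶠ x in nhds x₀, g x ∈ (chartAt (EuclideanSpace ℝ (Fin 3)) (g x₀)).source :=
    hgs.continuous.continuousAt (chart_source_mem_nhds _ (g x₀))
  filter_upwards [hsrc] with x hx
  rw [inTangentCoordinates_comp g g id _ _ hx, inTangentCoordinates_comp id g id _ _ hx]
  rfl

/-- Conjugation by `dφ_ρ` preserves complex structures on `ξ`, as `dφ_ρ` preserves `α` and the Reeb
vector field. -/
theorem isComplexStructure_transport (hα : IsContactForm α) (hJ : IsComplexStructure α J) (ρ : ℝ) :
    IsComplexStructure α (transport α J ρ) := by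
  have hαinv : ∀ (x : M) (v : EuclideanSpace ℝ (Fin 3)),
      α (reebFlow α (-ρ) x) (flowDeriv α (-ρ) x v) = α x v := apply_flowDeriv hα (-ρ)
  have hαinv' : ∀ (x : M) (v : EuclideanSpace ℝ (Fin 3)),
      α x (flowDeriv α ρ (reebFlow α (-ρ) x) v) = α (reebFlow α (-ρ) x) v := by
    intro x v
    refine Eq.trans ?_ (apply_flowDeriv hα ρ (reebFlow α (-ρ) x) v)
    have hcongr : ∀ p q : M, p = q → ∀ b : EuclideanSpace ℝ (Fin 3), α p b = α q b := by
      rintro p _ rfl b; rfl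
    exact hcongr _ _ (reebFlow_reebFlow_neg hα ρ x).symm _
  refine ⟨contMDiff_transport hα hJ ρ, fun x => ?_, fun x v hv => ?_, fun x v hv => ?_⟩
  · have h1 : flowDeriv α (-ρ) x (reebVec α x) = reebVec α (reebFlow α (-ρ) x) :=
      flowDeriv_reeb hα (-ρ) x
    have h2 : endoVec J (reebFlow α (-ρ) x) (reebVec α (reebFlow α (-ρ) x)) = 0 :=
      hJ.map_reeb (reebFlow α (-ρ) x)
    have h3 : endoVec (transport α J ρ) x (reebVec α x) = 0 := by
      rw [endoVec_transport, ContinuousLinearMap.comp_apply, ContinuousLinearMap.comp_apply, h1, h2,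
        map_zero]
    exact h3
  · exact (hαinv' x _).trans (hJ.map_mem _ _ ((hαinv x v).trans hv))
  · have hid : ∀ w : EuclideanSpace ℝ (Fin 3),
        flowDeriv α (-ρ) x (flowDeriv α ρ (reebFlow α (-ρ) x) w) = w := fun w =>
      congrArg (fun A : EuclideanSpace ℝ (Fin 3) →L[ℝ] EuclideanSpace ℝ (Fin 3) => A w)
        (flowDeriv_neg_comp_flowDeriv hα ρ x)
    have hid' : ∀ w : EuclideanSpace ℝ (Fin 3),
        flowDeriv α ρ (reebFlow α (-ρ) x) (flowDeriv α (-ρ) x w) = w := fun w =>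
      congrArg (fun A : EuclideanSpace ℝ (Fin 3) →L[ℝ] EuclideanSpace ℝ (Fin 3) => A w)
        (flowDeriv_comp_flowDeriv_neg hα ρ x)
    have hsq : ∀ w : EuclideanSpace ℝ (Fin 3), α (reebFlow α (-ρ) x) w = 0 →
        endoVec J (reebFlow α (-ρ) x) (endoVec J (reebFlow α (-ρ) x) w) = -w :=
      hJ.sq (reebFlow α (-ρ) x)
    have h : ∀ w : EuclideanSpace ℝ (Fin 3), α x w = 0 →
        endoVec (transport α J ρ) x (endoVec (transport α J ρ) x w) = -w := by
      intro w hw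
      simp only [endoVec_transport, ContinuousLinearMap.comp_apply]
      rw [hid, hsq _ ((hαinv x w).trans hw), map_neg, hid']
    exact h v hv

omit [T2Space M] [CompactSpace M] in
/-- The extension of a complex structure on `ξ` to `T(ℝ × M)` is an almost complex structure. -/
theorem extend_extend (hα : IsContactForm α) (hJ : IsComplexStructure α J) (q : ℝ × M)
    (w : ℝ × TangentSpace (𝓡 3) q.2) : extend α J q (extend α J q w) = -w := by
  obtain ⟨c, v⟩ := w
  have h1 := (reeb_spec hα q.2).1
  have hp : α q.2 (proj α q.2 v) = 0 := by simp [proj, h1]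
  have hJp := hJ.map_mem q.2 _ hp
  have hsq := hJ.sq q.2 _ hp
  have hr := hJ.map_reeb q.2
  have e0 : ∀ v : TangentSpace (𝓡 3) q.2, proj α q.2 v = v - α q.2 v • reeb α q.2 := fun v => rfl
  have hproj : proj α q.2 (J q.2 (proj α q.2 v)) = J q.2 (proj α q.2 v) := by
    rw [e0 (J q.2 _), hJp, zero_smul, sub_zero]
  have hprojr : proj α q.2 (reeb α q.2) = 0 := by simp [proj, h1]
  have e1 : ∀ (c : ℝ) (v : TangentSpace (𝓡 3) q.2), extend α J q (c, v) =
      (-α q.2 v, J q.2 (proj α q.2 v) + c • reeb α q.2) := fun c v => rfl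
  rw [e1, e1]
  simp only [map_add, map_smul, hproj, hprojr, hJp, h1, hsq, smul_zero, add_zero]
  refine Prod.ext (by simp) ?_
  simp only [Prod.snd_neg, e0]
  module

end Transport

/-! ### The twisted curve -/

theorem uniqueDiffOn_strip {R : ℝ} (hR : 0 < R) : UniqueDiffOn ℝ (strip R) :=
  (uniqueDiffOn_Icc (by linarith)).prod uniqueDiffOn_univ

theorem convex_strip (R : ℝ) : Convex ℝ (strip R) :=
  (convex_Icc _ _).prod convex_univ

theorem interior_strip (R : ℝ) : interior (strip R) = Ioo (-R) R ×ˢ univ := by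
  rw [strip, interior_prod_eq, interior_Icc, interior_univ]

theorem strip_subset_closure_interior {R : ℝ} (hR : 0 < R) :
    strip R ⊆ closure (interior (strip R)) := by
  rw [interior_strip, closure_prod_eq, closure_Ioo (by linarith), closure_univ]
  exact subset_rfl

theorem rot_rot (v : ℝ × ℝ) : rot (rot v) = -v := by
  ext <;> simp [rot]

section Twist

variable {M : Type*} [TopologicalSpace M] [T2Space M] [CompactSpace M]
  [ChartedSpace (EuclideanSpace ℝ (Fin 3)) M]
  [IsManifold (𝓡 3) ∞ M] {α : (x : M) → TangentSpace (𝓡 3) x →L[ℝ] ℝ}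
  {J : (x : M) → TangentSpace (𝓡 3) x →L[ℝ] TangentSpace (𝓡 3) x}

/-- `dφ_ρ` intertwines `J` and `J_ρ`. -/
theorem transport_reebFlow (hα : IsContactForm α) (ρ : ℝ) (x : M) (w : EuclideanSpace ℝ (Fin 3)) :
    endoVec (transport α J ρ) (reebFlow α ρ x) (flowDeriv α ρ x w) =
      flowDeriv α ρ x (endoVec J x w) := by
  obtain ⟨y, rfl⟩ : ∃ y, x = reebFlow α (-ρ) y :=
    ⟨reebFlow α ρ x, by rw [← reebFlow_add hα, neg_add_cancel, reebFlow_zero hα]⟩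
  have h := congrArg (fun A : EuclideanSpace ℝ (Fin 3) →L[ℝ] EuclideanSpace ℝ (Fin 3) => A w)
    (flowDeriv_neg_comp_flowDeriv hα ρ y)
  simp only [ContinuousLinearMap.comp_apply, ContinuousLinearMap.id_apply] at h
  rw [reebFlow_reebFlow_neg hα, endoVec_transport, ContinuousLinearMap.comp_apply,
    ContinuousLinearMap.comp_apply, h]

/-- `π_α` commutes with `dφ_ρ`, also after adding a multiple of the Reeb vector field. -/
theorem flowDeriv_proj (hα : IsContactForm α) (ρ : ℝ) (x : M) (c : ℝ)
    (w : EuclideanSpace ℝ (Fin 3)) :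
    endoVec (proj α) (reebFlow α ρ x) (c • reebVec α (reebFlow α ρ x) + flowDeriv α ρ x w) =
      flowDeriv α ρ x (endoVec (proj α) x w) := by
  have e : ∀ (y : M) (v : EuclideanSpace ℝ (Fin 3)),
      endoVec (proj α) y v = v - (α y v : ℝ) • reebVec α y := fun _ _ => rfl
  have h1 : α (reebFlow α ρ x) (reebVec α (reebFlow α ρ x)) = 1 := (reeb_spec hα _).1
  have h2 : flowDeriv α ρ x (reebVec α x) = reebVec α (reebFlow α ρ x) := flowDeriv_reeb hα ρ x
  have h3 : α (reebFlow α ρ x) (c • reebVec α (reebFlow α ρ x) + flowDeriv α ρ x w) =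
      c + α x w := by
    refine (map_add (α (reebFlow α ρ x)) _ _).trans ?_
    refine congrArg₂ (· + ·) ?_ (apply_flowDeriv hα ρ x w)
    exact ((α (reebFlow α ρ x)).map_smul c _).trans (by rw [h1, smul_eq_mul, mul_one])
  rw [e, e, h3, map_sub, map_smul, h2]
  module

variable {R : ℝ} {a : ℝ × ℝ → ℝ} {f : ℝ × ℝ → M} {γ : ℝ × ℝ → (ℝ × ℝ) →L[ℝ] ℝ}

theorem contMDiffOn_fBar (hα : IsContactForm α) (P : ℝ)
    (hf : ContMDiffOn 𝓘(ℝ, ℝ × ℝ) (𝓡 3) ∞ f (strip R)) :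
    ContMDiffOn 𝓘(ℝ, ℝ × ℝ) (𝓡 3) ∞ (fBar α P f) (strip R) :=
  contMDiffOn_reebFlow_comp hα hf (P • ContinuousLinearMap.fst ℝ ℝ ℝ)

theorem df_fBar (hα : IsContactForm α) (hR : 0 < R) (P : ℝ)
    (hf : ContMDiffOn 𝓘(ℝ, ℝ × ℝ) (𝓡 3) ∞ f (strip R)) {z : ℝ × ℝ} (hz : z ∈ strip R)
    (v : ℝ × ℝ) :
    df R (fBar α P f) z v =
      (P * v.1) • reebVec α (fBar α P f z) + flowDeriv α (P * z.1) (f z) (df R f z v) :=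
  mfderivWithin_reebFlow_comp hα (uniqueDiffOn_strip hR) hf
    (P • ContinuousLinearMap.fst ℝ ℝ ℝ) hz v

/-- `f̄^*α = f^*α + P ds`. -/
theorem apply_df_fBar (hα : IsContactForm α) (hR : 0 < R) (P : ℝ)
    (hf : ContMDiffOn 𝓘(ℝ, ℝ × ℝ) (𝓡 3) ∞ f (strip R)) {z : ℝ × ℝ} (hz : z ∈ strip R)
    (v : ℝ × ℝ) :
    α (fBar α P f z) (df R (fBar α P f) z v) = P * v.1 + α (f z) (df R f z v) := by
  refine (congrArg (α (fBar α P f z)) (df_fBar hα hR P hf hz v)).trans ?_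
  refine (map_add (α (fBar α P f z)) _ _).trans ?_
  refine congrArg₂ (· + ·) ?_ (apply_flowDeriv hα (P * z.1) (f z) (df R f z v))
  have h1 : α (fBar α P f z) (reebVec α (fBar α P f z)) = 1 := (reeb_spec hα _).1
  exact ((α (fBar α P f z)).map_smul (P * v.1) _).trans (by rw [h1, smul_eq_mul, mul_one])

theorem proj_df_fBar (hα : IsContactForm α) (hR : 0 < R) (P : ℝ)
    (hf : ContMDiffOn 𝓘(ℝ, ℝ × ℝ) (𝓡 3) ∞ f (strip R)) {z : ℝ × ℝ} (hz : z ∈ strip R)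
    (v : ℝ × ℝ) :
    proj α (fBar α P f z) (df R (fBar α P f) z v) =
      flowDeriv α (P * z.1) (f z) (proj α (f z) (df R f z v)) :=
  (congrArg (proj α (fBar α P f z)) (df_fBar hα hR P hf hz v)).trans
    (flowDeriv_proj hα (P * z.1) (f z) (P * v.1) (df R f z v))

theorem eq_contact_fBar (hα : IsContactForm α) (hR : 0 < R) (P : ℝ)
    (hu : IsHHolomorphic α J R a f γ) {z : ℝ × ℝ} (hz : z ∈ strip R) (v : ℝ × ℝ) :
    proj α (fBar α P f z) (df R (fBar α P f) z (rot v)) =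
      transport α J (P * z.1) (fBar α P f z)
        (proj α (fBar α P f z) (df R (fBar α P f) z v)) := by
  have hf := hu.smooth.smooth_snd
  refine (proj_df_fBar hα hR P hf hz (rot v)).trans ?_
  refine (congrArg (flowDeriv α (P * z.1) (f z)) (hu.eq_contact z hz v)).trans ?_
  refine (transport_reebFlow (J := J) hα (P * z.1) (f z) (proj α (f z) (df R f z v))).symm.trans ?_
  exact congrArg (transport α J (P * z.1) (fBar α P f z)) (proj_df_fBar hα hR P hf hz v).symm

omit [T2Space M] [CompactSpace M] [IsManifold (𝓡 3) ∞ M] in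
theorem da_add_potential (hR : 0 < R) (hu : IsSmoothCylinder R a f) {Γ : ℝ × ℝ → ℝ}
    (hΓ : IsPotential R γ Γ) {z : ℝ × ℝ} (hz : z ∈ strip R) (v : ℝ × ℝ) :
    da R (fun y => a y + Γ y) z v = da R a z v + (γ z v - period γ * v.2) := by
  have h1 : DifferentiableWithinAt ℝ a (strip R) z :=
    (hu.smooth_fst z hz).differentiableWithinAt (by simp)
  have h2 : DifferentiableWithinAt ℝ Γ (strip R) z :=
    (hΓ.smooth z hz).differentiableWithinAt (by simp)
  unfold da
  rw [fderivWithin_fun_add (uniqueDiffOn_strip hR z hz) h1 h2, hΓ.deriv_eq z hz]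
  simp
  ring

theorem eq_reeb_fBar (hα : IsContactForm α) (hR : 0 < R) (hu : IsHHolomorphic α J R a f γ)
    {Γ : ℝ × ℝ → ℝ} (hΓ : IsPotential R γ Γ) {z : ℝ × ℝ} (hz : z ∈ strip R) (v : ℝ × ℝ) :
    α (fBar α (period γ) f z) (df R (fBar α (period γ) f) z (rot v)) =
      da R (fun y => a y + Γ y) z v := by
  rw [apply_df_fBar hα hR _ hu.smooth.smooth_snd hz, hu.eq_reeb z hz,
    da_add_potential hR hu.smooth hΓ hz]
  simp [rot]
  ring

theorem isPseudoholomorphic_fBar (hα : IsContactForm α) (hR : 0 < R)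
    (hu : IsHHolomorphic α J R a f γ) {Γ : ℝ × ℝ → ℝ} (hΓ : IsPotential R γ Γ) :
    IsPseudoholomorphic (jBar α J (period γ)) R (fun z => a z + Γ z) (fBar α (period γ) f) := by
  refine ⟨⟨hu.smooth.smooth_fst.add hΓ.smooth,
    contMDiffOn_fBar hα _ hu.smooth.smooth_snd, fun s hs t => ?_, fun s hs t => ?_⟩,
    fun z hz v => ?_⟩
  · simp only [hu.smooth.periodic_fst s hs t, hΓ.periodic s hs t]
  · simp only [fBar, hu.smooth.periodic_snd s hs t]
  · set g := fBar α (period γ) f with hg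
    refine Prod.ext ?_ ?_
    · have h := eq_reeb_fBar hα hR hu hΓ hz (rot v)
      rw [rot_rot, map_neg, map_neg] at h
      exact h.symm
    · have h1 : df R g z (rot v) = proj α (g z) (df R g z (rot v)) +
          α (g z) (df R g z (rot v)) • reeb α (g z) := by simp [proj]
      rw [eq_contact_fBar hα hR _ hu hz, eq_reeb_fBar hα hR hu hΓ hz] at h1
      exact h1

end Twist

/-! ### The potential of the harmonic perturbation -/

theorem measurableSet_fund (R : ℝ) : MeasurableSet (fund R) :=
  measurableSet_Icc.prod measurableSet_Ico

theorem fund_subset_Icc (R : ℝ) : fund R ⊆ Icc (-R, 0) (R, 1) := by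
  rw [← Icc_prod_Icc]
  exact prod_mono subset_rfl Ico_subset_Icc_self

theorem Icc_subset_strip (R : ℝ) : Icc ((-R, 0) : ℝ × ℝ) (R, 1) ⊆ strip R := by
  rw [← Icc_prod_Icc]
  exact prod_mono subset_rfl (subset_univ _)

theorem fund_subset_strip (R : ℝ) : fund R ⊆ strip R :=
  (fund_subset_Icc R).trans (Icc_subset_strip R)

theorem fund_ae_eq_Icc (R : ℝ) : fund R =ᵐ[volume] Icc ((-R, 0) : ℝ × ℝ) (R, 1) := by
  rw [← Icc_prod_Icc]
  exact Measure.set_prod_ae_eq Filter.EventuallyEq.rfl Ico_ae_eq_Icc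

theorem integrableOn_fund {R : ℝ} {g : ℝ × ℝ → ℝ} (hg : ContinuousOn g (strip R)) :
    IntegrableOn g (fund R) :=
  ((hg.mono (Icc_subset_strip R)).integrableOn_compact isCompact_Icc).mono_set (fund_subset_Icc R)

theorem volume_real_fund {R : ℝ} (hR : 0 < R) : volume.real (fund R) = 2 * R := by
  rw [fund, Measure.volume_eq_prod, measureReal_prod_prod, Real.volume_real_Icc_of_le (by linarith),
    Real.volume_real_Ico_of_le zero_le_one]
  ring

theorem strip_mem_nhds_zero {R : ℝ} (hR : 0 < R) (t : ℝ) : strip R ∈ nhds ((0, t) : ℝ × ℝ) :=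
  prod_mem_nhds (Icc_mem_nhds (by linarith) hR) Filter.univ_mem

/-- A function on the strip whose differential is `-P(γ) dt + γ` descends to the cylinder: by
periodicity of `γ`, the difference `Γ(s, t + 1) - Γ(s, t)` is constant, and it vanishes because
`P(γ)` is the integral of `γ` over the circle `{0} × S¹`. -/
theorem isPeriodic_of_hasFDerivWithinAt {R : ℝ} (hR : 0 < R) {γ : ℝ × ℝ → (ℝ × ℝ) →L[ℝ] ℝ}
    (hγ : ContinuousOn γ (strip R)) (hper : IsPeriodic R γ) {Γ : ℝ × ℝ → ℝ}
    (hΓ : ∀ z ∈ strip R, HasFDerivWithinAt Γ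
      (-(period γ • ContinuousLinearMap.snd ℝ ℝ ℝ) + γ z) (strip R) z) :
    IsPeriodic R Γ := by
  have hshift : ∀ z ∈ strip R, HasFDerivWithinAt (fun z : ℝ × ℝ => Γ (z + (0, 1)) - Γ z)
      (0 : ℝ × ℝ →L[ℝ] ℝ) (strip R) z := by
    intro z hz
    have h1 : HasFDerivWithinAt (fun z : ℝ × ℝ => z + (0, 1))
        (ContinuousLinearMap.id ℝ (ℝ × ℝ)) (strip R) z :=
      (hasFDerivWithinAt_id z _).add_const (0, 1)
    have hmaps : MapsTo (fun z : ℝ × ℝ => z + (0, 1)) (strip R) (strip R) := by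
      intro y hy
      exact ⟨by simpa using hy.1, mem_univ _⟩
    have h2 := ((hΓ _ (hmaps hz)).comp z h1 hmaps).fun_sub (hΓ z hz)
    have h3 : γ (z + (0, 1)) = γ z := by
      obtain ⟨s, t⟩ := z
      simpa using hper s hz.1 t
    rw [h3] at h2
    refine h2.congr_fderiv ?_
    ext <;> simp
  have hzero : ∀ z ∈ strip R,
      fderivWithin ℝ (fun z : ℝ × ℝ => Γ (z + (0, 1)) - Γ z) (strip R) z = 0 :=
    fun z hz => (hshift z hz).fderivWithin (uniqueDiffOn_strip hR z hz)
  have h0 : ((0, 0) : ℝ × ℝ) ∈ strip R := mem_of_mem_nhds (strip_mem_nhds_zero hR 0)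
  have hline : ∀ t : ℝ, HasDerivAt (fun t => Γ (0, t)) (-period γ + γ (0, t) (0, 1)) t := by
    intro t
    have h1 := (hΓ (0, t) (mem_of_mem_nhds (strip_mem_nhds_zero hR t))).hasFDerivAt
      (strip_mem_nhds_zero hR t)
    have h2 : HasDerivAt (fun t : ℝ => ((0 : ℝ), t)) ((0 : ℝ), (1 : ℝ)) t :=
      (hasDerivAt_const t (0 : ℝ)).prodMk (hasDerivAt_id t)
    exact (h1.comp_hasDerivAt t h2).congr_deriv (by simp)
  have hcont : Continuous fun t : ℝ => γ (0, t) (0, 1) := by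
    have h1 : Continuous fun t : ℝ => γ (0, t) :=
      hγ.comp_continuous (by fun_prop)
        (fun t => mem_of_mem_nhds (strip_mem_nhds_zero hR t))
    exact h1.clm_apply continuous_const
  have hint := intervalIntegral.integral_eq_sub_of_hasDerivAt (a := 0) (b := 1)
    (fun t _ => hline t) ((continuous_const.add hcont).intervalIntegrable _ _)
  rw [intervalIntegral.integral_add (by simp) (hcont.intervalIntegrable _ _),
    intervalIntegral.integral_const] at hint
  have hΓ01 : Γ (0, 1) - Γ (0, 0) = 0 := by
    rw [← hint]
    simp [period]
  intro s hs t
  have h := (convex_strip R).is_const_of_fderivWithin_eq_zero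
    (fun z hz => (hshift z hz).differentiableWithinAt) hzero
    (show (s, t) ∈ strip R from ⟨hs, mem_univ _⟩) h0
  simp only [Prod.mk_add_mk, add_zero, zero_add, hΓ01] at h
  linarith

theorem exists_isPotential {R : ℝ} (hR : 0 < R) {γ : ℝ × ℝ → (ℝ × ℝ) →L[ℝ] ℝ}
    (hγ : IsHarmonicForm R γ) : ∃ Γ : ℝ × ℝ → ℝ, IsPotential R γ Γ := by
  set θ : ℝ × ℝ → (ℝ × ℝ) →L[ℝ] ℝ :=
    fun z => -(period γ • ContinuousLinearMap.snd ℝ ℝ ℝ) + γ z with hθ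
  have hθs : ContDiffOn ℝ ∞ θ (strip R) := contDiffOn_const.add hγ.smooth
  obtain ⟨Γ, hΓ⟩ := (convex_strip R).exists_forall_hasFDerivWithinAt_of_fderivWithin_symmetric
    (hθs.differentiableOn (by simp)) (fun z hz v _ w _ => by
      have h := hγ.closed z hz v w
      rw [hθ, fderivWithin_const_add]
      exact sub_eq_zero.1 h)
  have hd : ∀ z ∈ strip R, fderivWithin ℝ Γ (strip R) z = θ z := fun z hz =>
    (hΓ z hz).fderivWithin (uniqueDiffOn_strip hR z hz)
  refine ⟨Γ, ?_, isPeriodic_of_hasFDerivWithinAt hR hγ.smooth.continuousOn hγ.periodic hΓ, hd⟩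
  rw [show (∞ : WithTop ℕ∞) = ∞ + 1 from rfl,
    contDiffOn_succ_iff_fderivWithin (uniqueDiffOn_strip hR)]
  exact ⟨fun z hz => (hΓ z hz).differentiableWithinAt, by simp, hθs.congr hd⟩

theorem exists_isPotential_integral_eq_zero {R : ℝ} (hR : 0 < R) {γ : ℝ × ℝ → (ℝ × ℝ) →L[ℝ] ℝ}
    (hγ : IsHarmonicForm R γ) :
    ∃ Γ : ℝ × ℝ → ℝ, IsPotential R γ Γ ∧ 1 / (2 * R) * (∫ z in fund R, Γ z) = 0 := by
  obtain ⟨Γ, hΓ⟩ := exists_isPotential hR hγ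
  set c : ℝ := 1 / (2 * R) * ∫ z in fund R, Γ z with hc
  refine ⟨fun z => Γ z - c, ⟨hΓ.smooth.sub contDiffOn_const, fun s hs t => ?_, fun z hz => ?_⟩, ?_⟩
  · simp only [hΓ.periodic s hs t]
  · rw [fderivWithin_sub_const, hΓ.deriv_eq z hz]
  · have hconst : IntegrableOn (fun _ : ℝ × ℝ => c) (fund R) :=
      integrableOn_fund continuousOn_const
    rw [integral_sub (integrableOn_fund hΓ.smooth.continuousOn) hconst, setIntegral_const,
      volume_real_fund hR, smul_eq_mul, hc]
    field_simp
    ring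

/-! ### The energies of the twisted curve -/

/-- Stokes' theorem on the cylinder for a one-form `β`. Only the `ds`-coefficient of `β` has to be
periodic, and only along the boundary of the fundamental domain. -/
theorem integral_dForm_fund {R : ℝ} (hR : 0 < R) {β : ℝ × ℝ → (ℝ × ℝ) →L[ℝ] ℝ}
    (hβ : ContDiffOn ℝ ∞ β (strip R))
    (hper : ∀ s ∈ Icc (-R) R, β (s, 1) (1, 0) = β (s, 0) (1, 0)) :
    ∫ z in fund R, dForm (strip R) β z (1, 0) (0, 1) =
      (∫ t in (0 : ℝ)..1, β (R, t) (0, 1)) - ∫ t in (0 : ℝ)..1, β (-R, t) (0, 1) := by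
  have hd : ∀ z ∈ Ioo (-R) R ×ˢ Ioo (0 : ℝ) 1,
      HasFDerivAt β (fderivWithin ℝ β (strip R) z) z := fun z hz => by
    have hz' : strip R ∈ nhds z :=
      prod_mem_nhds (Icc_mem_nhds hz.1.1 hz.1.2) Filter.univ_mem
    exact ((hβ z (mem_of_mem_nhds hz')).differentiableWithinAt
      (by simp)).hasFDerivWithinAt.hasFDerivAt hz'
  have hdv : ∀ u : ℝ × ℝ, ∀ z ∈ Ioo (-R) R ×ˢ Ioo (0 : ℝ) 1, HasFDerivAt (fun z => β z u)
      ((fderivWithin ℝ β (strip R) z).flip u) z := fun u z hz => by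
    simpa using (hd z hz).clm_apply (hasFDerivAt_const u z)
  have hcv : ∀ u : ℝ × ℝ, ContinuousOn (fun z => β z u) (Icc (-R, 0) (R, 1)) := fun u =>
    (hβ.continuousOn.clm_apply continuousOn_const).mono (Icc_subset_strip R)
  have hd' : ContinuousOn (fderivWithin ℝ β (strip R)) (strip R) :=
    hβ.continuousOn_fderivWithin (uniqueDiffOn_strip hR) (by simp)
  have hcd : ContinuousOn (fun z => dForm (strip R) β z (1, 0) (0, 1)) (strip R) :=
    ((hd'.clm_apply continuousOn_const).clm_apply continuousOn_const).sub
      ((hd'.clm_apply continuousOn_const).clm_apply continuousOn_const)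
  have hdiv := integral_divergence_prod_Icc_of_hasFDerivAt_of_le (fun z => β z (0, 1))
    (fun z => -β z (1, 0)) (fun z => (fderivWithin ℝ β (strip R) z).flip (0, 1))
    (fun z => -(fderivWithin ℝ β (strip R) z).flip (1, 0)) (-R, 0) (R, 1)
    ⟨by simpa using hR.le, zero_le_one⟩ (hcv _) (hcv _).neg (hdv _) (fun z hz => (hdv _ z hz).neg)
    (by
      refine ((hcd.mono (Icc_subset_strip R)).integrableOn_compact isCompact_Icc).congr_fun
        (fun z _ => ?_) measurableSet_Icc
      simp [dForm, sub_eq_add_neg])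
  have hside : ∫ s in (-R)..R, -β (s, 1) (1, 0) = ∫ s in (-R)..R, -β (s, 0) (1, 0) := by
    refine intervalIntegral.integral_congr fun s hs => ?_
    rw [uIcc_of_le (by linarith)] at hs
    simp only [hper s hs]
  simp only [hside, sub_self, zero_add] at hdiv
  rw [setIntegral_congr_set (fund_ae_eq_Icc R), ← hdiv]
  refine setIntegral_congr_fun measurableSet_Icc fun z _ => ?_
  simp [dForm, sub_eq_add_neg]

theorem da_periodic_snd {R : ℝ} {a : ℝ × ℝ → ℝ} (ha : ContDiffOn ℝ ∞ a (strip R))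
    (hper : IsPeriodic R a) {s : ℝ} (hs : s ∈ Icc (-R) R) :
    da R a (s, 1) (0, 1) = da R a (s, 0) (0, 1) := by
  have hline : ∀ t : ℝ, HasDerivAt (fun t => a (s, t)) (da R a (s, t) (0, 1)) t := by
    intro t
    have h1 : HasDerivWithinAt (fun t : ℝ => (s, t)) ((0 : ℝ), (1 : ℝ)) univ t :=
      ((hasDerivAt_const t s).prodMk (hasDerivAt_id t)).hasDerivWithinAt
    have h2 := ((ha (s, t) ⟨hs, mem_univ _⟩).differentiableWithinAt
      (by simp)).hasFDerivWithinAt.comp_hasDerivWithinAt t h1 (fun t _ => ⟨hs, mem_univ _⟩)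
    exact hasDerivWithinAt_univ.1 h2
  have h1 : HasDerivAt (fun t => a (s, t + 1)) (da R a (s, 0 + 1) (0, 1)) 0 :=
    (hline (0 + 1)).comp_add_const 0 1
  have h2 : (fun t => a (s, t + 1)) = fun t => a (s, t) := funext fun t => hper s hs t
  rw [h2, zero_add] at h1
  exact h1.unique (hline 0)

/-- The bound for the `α`-energy of a pseudoholomorphic curve: with `β = f^*α`, one has
`d(φ(a) β) = φ'(a) da ∘ i ∧ da + φ(a) dβ`, and `dβ ≥ 0`. -/
theorem integral_deriv_le_of_dForm_nonneg {R : ℝ} (hR : 0 < R) {a : ℝ × ℝ → ℝ}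
    (ha : ContDiffOn ℝ ∞ a (strip R)) (hper : IsPeriodic R a)
    {β : ℝ × ℝ → (ℝ × ℝ) →L[ℝ] ℝ} (hβ : ContDiffOn ℝ ∞ β (strip R))
    (hβa : ∀ z ∈ strip R, ∀ v, β z (rot v) = da R a z v)
    (hdβ : ∀ z ∈ strip R, 0 ≤ dForm (strip R) β z (1, 0) (0, 1)) {φ : ℝ → ℝ}
    (hφ : φ ∈ admissible) :
    ∫ z in fund R, deriv φ (a z) *
        (da R a z (rot (1, 0)) * da R a z (0, 1) - da R a z (rot (0, 1)) * da R a z (1, 0)) ≤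
      (∫ t in (0 : ℝ)..1, |β (R, t) (0, 1)|) + ∫ t in (0 : ℝ)..1, |β (-R, t) (0, 1)| := by
  obtain ⟨hφs, hφ01, -⟩ := hφ
  have hrot1 : rot (1, 0) = (0, 1) := by ext <;> simp [rot]
  have hrot2 : rot (0, 1) = -(1, 0) := by ext <;> simp [rot]
  have hβ01 : ∀ z ∈ strip R, β z (0, 1) = da R a z (1, 0) := fun z hz => by
    rw [← hβa z hz, hrot1]
  have hβ10 : ∀ z ∈ strip R, β z (1, 0) = -da R a z (0, 1) := fun z hz => by
    rw [← hβa z hz, hrot2, map_neg, neg_neg]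
  set κ : ℝ × ℝ → (ℝ × ℝ) →L[ℝ] ℝ := fun z => φ (a z) • β z with hκ
  have hφa : ContDiffOn ℝ ∞ (fun z => φ (a z)) (strip R) := hφs.comp_contDiffOn ha
  have hκs : ContDiffOn ℝ ∞ κ (strip R) := hφa.smul hβ
  have hdκ : ∀ z ∈ strip R, dForm (strip R) κ z (1, 0) (0, 1) =
      deriv φ (a z) * (da R a z (rot (1, 0)) * da R a z (0, 1) -
        da R a z (rot (0, 1)) * da R a z (1, 0)) +
        φ (a z) * dForm (strip R) β z (1, 0) (0, 1) := by
    intro z hz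
    have h1 : HasFDerivWithinAt a (da R a z) (strip R) z :=
      ((ha z hz).differentiableWithinAt (by simp)).hasFDerivWithinAt
    have h2 : HasDerivAt φ (deriv φ (a z)) (a z) :=
      (hφs.differentiable (by simp) (a z)).hasDerivAt
    have h3 : HasFDerivWithinAt β (fderivWithin ℝ β (strip R) z) (strip R) z :=
      ((hβ z hz).differentiableWithinAt (by simp)).hasFDerivWithinAt
    have h4 := ((h2.comp_hasFDerivWithinAt z h1).smul h3).fderivWithin (uniqueDiffOn_strip hR z hz)
    have h5 : fderivWithin ℝ κ (strip R) z = _ := h4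
    rw [dForm, h5, hrot1, hrot2]
    simp only [Function.comp_apply, _root_.add_apply, _root_.smul_apply,
      ContinuousLinearMap.smulRight_apply, smul_eq_mul, map_neg, hβ01 z hz, hβ10 z hz, dForm]
    ring
  have hstokes := integral_dForm_fund hR hκs (fun s hs => by
    have h0 : (s, (0 : ℝ)) ∈ strip R := ⟨hs, mem_univ _⟩
    have h1 : (s, (1 : ℝ)) ∈ strip R := ⟨hs, mem_univ _⟩
    have h2 : a (s, 1) = a (s, 0) := by simpa using hper s hs 0
    simp only [hκ, _root_.smul_apply, hβ10 _ h0, hβ10 _ h1, h2,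
      da_periodic_snd ha hper hs])
  have hbdry : ∀ s ∈ Icc (-R) R, |∫ t in (0 : ℝ)..1, κ (s, t) (0, 1)| ≤
      ∫ t in (0 : ℝ)..1, |β (s, t) (0, 1)| := by
    intro s hs
    have hc : Continuous fun t : ℝ => β (s, t) (0, 1) :=
      (hβ.continuousOn.comp_continuous (by fun_prop) (fun t => ⟨hs, mem_univ _⟩)).clm_apply
        continuous_const
    have hcφ : Continuous fun t : ℝ => φ (a (s, t)) :=
      hφa.continuousOn.comp_continuous (by fun_prop) (fun t => ⟨hs, mem_univ _⟩)
    refine (intervalIntegral.abs_integral_le_integral_abs zero_le_one).trans ?_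
    refine intervalIntegral.integral_mono_on zero_le_one
      ((hcφ.mul hc).abs.intervalIntegrable _ _) (hc.abs.intervalIntegrable _ _) fun t _ => ?_
    change |φ (a (s, t)) * β (s, t) (0, 1)| ≤ _
    rw [abs_mul, abs_of_nonneg (hφ01 _).1]
    exact mul_le_of_le_one_left (abs_nonneg _) (hφ01 _).2
  have hle : ∫ z in fund R, deriv φ (a z) *
        (da R a z (rot (1, 0)) * da R a z (0, 1) - da R a z (rot (0, 1)) * da R a z (1, 0)) ≤
      ∫ z in fund R, dForm (strip R) κ z (1, 0) (0, 1) := by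
    have hda : ContinuousOn (da R a) (strip R) :=
      ha.continuousOn_fderivWithin (uniqueDiffOn_strip hR) (by simp)
    have hdav : ∀ v : ℝ × ℝ, ContinuousOn (fun z => da R a z v) (strip R) := fun v =>
      hda.clm_apply continuousOn_const
    have hdκ' : ContinuousOn (fderivWithin ℝ κ (strip R)) (strip R) :=
      hκs.continuousOn_fderivWithin (uniqueDiffOn_strip hR) (by simp)
    have hφ' : ContinuousOn (fun z => deriv φ (a z)) (strip R) :=
      (hφs.continuous_deriv (by simp)).comp_continuousOn ha.continuousOn
    refine setIntegral_mono_on (integrableOn_fund (hφ'.mul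
      (((hdav _).mul (hdav _)).sub ((hdav _).mul (hdav _))))) (integrableOn_fund
      (((hdκ'.clm_apply continuousOn_const).clm_apply continuousOn_const).sub
      ((hdκ'.clm_apply continuousOn_const).clm_apply continuousOn_const)))
      (measurableSet_fund R) fun z hz => ?_
    have hz' := fund_subset_strip R hz
    rw [hdκ z hz']
    exact le_add_of_nonneg_right (mul_nonneg (hφ01 _).1 (hdβ z hz'))
  rw [hstokes] at hle
  have h1 := (le_abs_self _).trans (hbdry R ⟨by linarith, le_rfl⟩)
  have h2 := (neg_le_abs _).trans (hbdry (-R) ⟨le_rfl, by linarith⟩)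
  linarith

section Energy

variable {M : Type*} [TopologicalSpace M] [T2Space M] [CompactSpace M]
  [ChartedSpace (EuclideanSpace ℝ (Fin 3)) M]
  [IsManifold (𝓡 3) ∞ M] {α : (x : M) → TangentSpace (𝓡 3) x →L[ℝ] ℝ}
  {J : (x : M) → TangentSpace (𝓡 3) x →L[ℝ] TangentSpace (𝓡 3) x}
  {R : ℝ} {a : ℝ × ℝ → ℝ} {f : ℝ × ℝ → M} {γ : ℝ × ℝ → (ℝ × ℝ) →L[ℝ] ℝ}

omit [T2Space M] [CompactSpace M] in
theorem dForm_pullForm_strip (hα : IsContactForm α) (hR : 0 < R)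
    (hf : ContMDiffOn 𝓘(ℝ, ℝ × ℝ) (𝓡 3) ∞ f (strip R)) {z : ℝ × ℝ} (hz : z ∈ strip R)
    (v w : ℝ × ℝ) :
    dForm (strip R) (pullForm α (strip R) f) z v w =
      dAlpha α (f z) (df R f z v) (df R f z w) :=
  dForm_pullForm hα.smooth (uniqueDiffOn_strip hR) (strip_subset_closure_interior hR) hf hz v w

/-- `f̄^*dα = f^*dα`, because `f̄^*α` and `f^*α` differ by the closed form `P ds`. -/
theorem dAlpha_df_fBar (hα : IsContactForm α) (hR : 0 < R) (P : ℝ)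
    (hf : ContMDiffOn 𝓘(ℝ, ℝ × ℝ) (𝓡 3) ∞ f (strip R)) {z : ℝ × ℝ} (hz : z ∈ strip R)
    (v w : ℝ × ℝ) :
    dAlpha α (fBar α P f z) (df R (fBar α P f) z v) (df R (fBar α P f) z w) =
      dAlpha α (f z) (df R f z v) (df R f z w) := by
  have heq : EqOn (pullForm α (strip R) (fBar α P f))
      (fun z => P • ContinuousLinearMap.fst ℝ ℝ ℝ + pullForm α (strip R) f z) (strip R) :=
    fun y hy => ContinuousLinearMap.ext fun u => apply_df_fBar hα hR P hf hy u
  rw [← dForm_pullForm_strip hα hR (contMDiffOn_fBar hα P hf) hz,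
    ← dForm_pullForm_strip hα hR hf hz, dForm, dForm,
    fderivWithin_congr heq (heq hz), fderivWithin_const_add]

theorem dAlphaEnergy_fBar (hα : IsContactForm α) (hR : 0 < R) (P : ℝ)
    (hf : ContMDiffOn 𝓘(ℝ, ℝ × ℝ) (𝓡 3) ∞ f (strip R)) :
    dAlphaEnergy α R (fBar α P f) = dAlphaEnergy α R f :=
  setIntegral_congr_fun (measurableSet_fund R) fun _ hz =>
    dAlpha_df_fBar hα hR P hf (fund_subset_strip R hz) _ _

omit [T2Space M] [CompactSpace M] in
theorem dAlpha_proj_proj (hα : IsContactForm α) (x : M) (v w : TangentSpace (𝓡 3) x) :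
    dAlpha α x (proj α x v) (proj α x w) = dAlpha α x v w := by
  have hadd : ∀ p q r, dAlpha α x (p + q) r = dAlpha α x p r + dAlpha α x q r :=
    dForm_add (E := EuclideanSpace ℝ (Fin 3)) _ _ _
  have hsmul : ∀ (c : ℝ) p r, dAlpha α x (c • p) r = c * dAlpha α x p r :=
    dForm_smul (E := EuclideanSpace ℝ (Fin 3)) _ _ _
  have hanti : ∀ p q, dAlpha α x p q = -dAlpha α x q p := fun p q => by
    unfold dAlpha dForm; ring
  have h1 : ∀ v w, dAlpha α x (proj α x v) w = dAlpha α x v w := by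
    intro v w
    have e : proj α x v = v + (-(α x v)) • reeb α x := by
      rw [neg_smul, ← sub_eq_add_neg]; rfl
    rw [e, hadd, hsmul, (reeb_spec hα x).2 w, mul_zero, add_zero]
  rw [h1, hanti, h1, ← hanti]

omit [T2Space M] [CompactSpace M] in
/-- The density `f^*dα(∂_s, ∂_t) = |π_α ∂_s f|²` is nonnegative. -/
theorem dAlpha_df_nonneg (hα : IsContactForm α) (hJα : IsCompatible α J)
    (hu : IsHHolomorphic α J R a f γ) {z : ℝ × ℝ} (hz : z ∈ strip R) :
    0 ≤ dAlpha α (f z) (df R f z (1, 0)) (df R f z (0, 1)) := by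
  have hrot : rot (1, 0) = (0, 1) := by ext <;> simp [rot]
  have h := hu.eq_contact z hz (1, 0)
  rw [hrot] at h
  rw [← dAlpha_proj_proj hα, h]
  set p := proj α (f z) (df R f z (1, 0)) with hp
  have hp0 : α (f z) p = 0 := by simp [hp, proj, (reeb_spec hα (f z)).1]
  rcases eq_or_ne p 0 with h0 | h0
  · have hsmul := dForm_smul (E := EuclideanSpace ℝ (Fin 3)) (extChartAt (𝓡 3) (f z)).target
      (inChart α (f z)) (extChartAt (𝓡 3) (f z) (f z)) 0 0 (J (f z) p)
    rw [zero_mul, zero_smul] at hsmul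
    exact (hsmul.symm.trans (congrArg (fun q => dAlpha α (f z) q (J (f z) p)) h0.symm)).le
  · exact (hJα.pos (f z) p hp0 h0).le

omit [T2Space M] [CompactSpace M] in
theorem dAlphaEnergy_nonneg (hα : IsContactForm α) (hJα : IsCompatible α J)
    (hu : IsHHolomorphic α J R a f γ) : 0 ≤ dAlphaEnergy α R f :=
  setIntegral_nonneg (measurableSet_fund R) fun _ hz =>
    dAlpha_df_nonneg hα hJα hu (fund_subset_strip R hz)

/-- The boundary integrals are those of `f`, because `f̄^*α = f^*α + P ds` agrees with `f^*α` on
`∂_t`. -/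
theorem alphaEnergy_fBar_le (hα : IsContactForm α) (hJα : IsCompatible α J) (hR : 0 < R)
    (hu : IsHHolomorphic α J R a f γ) {Γ : ℝ × ℝ → ℝ} (hΓ : IsPotential R γ Γ) :
    alphaEnergy R (fun z => a z + Γ z) ≤
      ((circleAlpha α R f R + circleAlpha α R f (-R) + dAlphaEnergy α R f : ℝ) : EReal) := by
  have hf := hu.smooth.smooth_snd
  have hū := (isPseudoholomorphic_fBar hα hR hu hΓ).smooth
  set g := fBar α (period γ) f with hg
  have hcirc : ∀ s ∈ Icc (-R) R, ∫ t in (0 : ℝ)..1, |pullForm α (strip R) g (s, t) (0, 1)| =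
      circleAlpha α R f s := by
    intro s hs
    refine intervalIntegral.integral_congr fun t _ => congrArg abs ?_
    refine (apply_df_fBar hα hR (period γ) hf (z := (s, t)) ⟨hs, mem_univ _⟩ (0, 1)).trans ?_
    simp
  refine iSup₂_le fun φ hφ => EReal.coe_le_coe_iff.2 ?_
  have h := integral_deriv_le_of_dForm_nonneg hR hū.smooth_fst hū.periodic_fst
    (contDiffOn_pullForm hα.smooth (uniqueDiffOn_strip hR) hū.smooth_snd)
    (fun z hz v => eq_reeb_fBar hα hR hu hΓ hz v)
    (fun z hz => by
      rw [dForm_pullForm_strip hα hR hū.smooth_snd hz, dAlpha_df_fBar hα hR _ hf hz]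
      exact dAlpha_df_nonneg hα hJα hu hz) hφ
  rw [hcirc R ⟨by linarith, le_rfl⟩, hcirc (-R) ⟨le_rfl, by linarith⟩] at h
  linarith [dAlphaEnergy_nonneg hα hJα hu]

end Energy

end HCyl

theorem mainTheorem6 {M : Type*} [TopologicalSpace M] [T2Space M] [CompactSpace M]
    [ChartedSpace (EuclideanSpace ℝ (Fin 3)) M] [IsManifold (𝓡 3) ∞ M]
    (α : (x : M) → TangentSpace (𝓡 3) x →L[ℝ] ℝ) (hα : HCyl.IsContactForm α)
    (J : (x : M) → TangentSpace (𝓡 3) x →L[ℝ] TangentSpace (𝓡 3) x)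
    (hJ : HCyl.IsComplexStructure α J) (hJα : HCyl.IsCompatible α J)
    (R : ℝ) (hR : 0 < R) (a : ℝ × ℝ → ℝ) (f : ℝ × ℝ → M) (γ : ℝ × ℝ → (ℝ × ℝ) →L[ℝ] ℝ)
    (hu : HCyl.IsHHolomorphic α J R a f γ) :
    -- every `J_ρ` is a complex structure on `ξ`, and `J̄_P` is an `ℝ`-invariant almost complex
    -- structure on `ℝ × M`
    (∀ ρ : ℝ, HCyl.IsComplexStructure α (HCyl.transport α J ρ)) ∧
    (∀ (z : ℝ × ℝ) (r : ℝ) (m : M) (w : ℝ × TangentSpace (𝓡 3) m),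
      HCyl.jBar α J (HCyl.period γ) z (r, m) (HCyl.jBar α J (HCyl.period γ) z (r, m) w) = -w) ∧
    (∀ (z : ℝ × ℝ) (r r' : ℝ) (m : M) (w : ℝ × TangentSpace (𝓡 3) m),
      HCyl.jBar α J (HCyl.period γ) z (r, m) w = HCyl.jBar α J (HCyl.period γ) z (r', m) w) ∧
    -- the potential `Γ` exists, and can be chosen with vanishing mean value
    (∃ Γ : ℝ × ℝ → ℝ, HCyl.IsPotential R γ Γ ∧ 1 / (2 * R) * (∫ z in HCyl.fund R, Γ z) = 0) ∧
    ∀ Γ : ℝ × ℝ → ℝ, HCyl.IsPotential R γ Γ →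
      -- the curve `ū = (a + Γ, f̄)` is pseudoholomorphic
      HCyl.IsPseudoholomorphic (HCyl.jBar α J (HCyl.period γ)) R (fun z => a z + Γ z)
        (HCyl.fBar α (HCyl.period γ) f) ∧
      (∀ z ∈ HCyl.strip R, ∀ v : ℝ × ℝ,
        HCyl.proj α (HCyl.fBar α (HCyl.period γ) f z)
            (HCyl.df R (HCyl.fBar α (HCyl.period γ) f) z (HCyl.rot v)) =
          HCyl.transport α J (HCyl.period γ * z.1) (HCyl.fBar α (HCyl.period γ) f z)
            (HCyl.proj α (HCyl.fBar α (HCyl.period γ) f z)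
              (HCyl.df R (HCyl.fBar α (HCyl.period γ) f) z v))) ∧
      (∀ z ∈ HCyl.strip R, ∀ v : ℝ × ℝ,
        α (HCyl.fBar α (HCyl.period γ) f z)
            (HCyl.df R (HCyl.fBar α (HCyl.period γ) f) z (HCyl.rot v)) =
          HCyl.da R (fun y => a y + Γ y) z v) ∧
      -- the energies of `ū`
      HCyl.dAlphaEnergy α R (HCyl.fBar α (HCyl.period γ) f) = HCyl.dAlphaEnergy α R f ∧
      HCyl.alphaEnergy R (fun z => a z + Γ z) ≤
        ((HCyl.circleAlpha α R f R + HCyl.circleAlpha α R f (-R) +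
          HCyl.dAlphaEnergy α R f : ℝ) : EReal) := by
  exact ⟨fun ρ => HCyl.isComplexStructure_transport hα hJ ρ,
    fun z r m w =>
      HCyl.extend_extend hα (HCyl.isComplexStructure_transport hα hJ _) (r, m) w,
    fun _ _ _ _ _ => rfl,
    HCyl.exists_isPotential_integral_eq_zero hR hu.harmonic,
    fun Γ hΓ => ⟨HCyl.isPseudoholomorphic_fBar hα hR hu hΓ,
      fun _ hz v => HCyl.eq_contact_fBar hα hR _ hu hz v,
      fun _ hz v => HCyl.eq_reeb_fBar hα hR hu hΓ hz v,
      HCyl.dAlphaEnergy_fBar hα hR _ hu.smooth.smooth_snd,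
      HCyl.alphaEnergy_fBar_le hα hJα hR hu hΓ⟩⟩
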